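/- Fix a real number $\alpha>1$ and for real $a$ let $f_a(x)=-|x|^{\alpha}+a$. Write $n_a=f_a^{n}(0)/f_a(0)$ for the rescaled post-critical orbit, so that $0_a=0$ and $1_a=1$. For pairwise distinct reals $p,q,x$ with $x$ between $p$ and $q$ let $p_{p,q}(x)=\ln\frac{x-p}{q-x}$ be the Poincaré coordinate of $x$ in the oriented interval $(p,q)$ (where $p>q$ is allowed), and set $\bar a=p_{0,1}(|2_a|)$. Consider the parameters $a$ for which the kneading sequence of $f_a$ (the itinerary of the critical value $f_a(0)$ with respect to the critical point $0$) is $RLRLRL\ldots$, i.e. $f_a^{k}(0)>0$ for all odd $k$ and $f_a^{k}(0)<0$ for all even $k\ge 2$. On this set of parameters $\bar a$ is a strictly increasing function of $a$, and its range is a half-line $(-\infty,\bar a_1)$ with $\bar a_1\in\mathbb{R}$ depending only on $\alpha$. For every integer $n\ge 0$ the ratios $$r^n_e=\frac{|(2n+4)_a-(2n+2)_a|}{|(2n+2)_a-(2n)_a|}\qquad\text{and}\qquad r^n_o=\frac{|(2n+5)_a-(2n+3)_a|}{|(2n+3)_a-(2n+1)_a|}$$ are strictly increasing functions of $\bar a\in(-\infty,\bar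 a_1)$. Moreover, if $\bar a<\bar a'$ are the values of the new parameter at two such parameters $a,a'$, then for every integer $n\ge 0$ $$p_{(n+2)_{a'},\,n_{a'}}\big((n+4)_{a'}\big)-p_{(n+2)_{a},\,n_{a}}\big((n+4)_{a}\big)>p_{1,-1}(2_{a'})-p_{1,-1}(2_a).$$ -/

import Mathlib

noncomputable section

namespace PowerLaw

/-- Poincaré coordinate of `x` in the oriented interval from `p` to `q` (also used when `q < p`). -/
def poincare (p q x : ℝ) : ℝ := Real.log ((x - p) / (q - x))

/-- The unimodal power-law map `f_a(x) = -|x|^α + a`. -/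
def f (α a x : ℝ) : ℝ := -|x| ^ α + a

/-- The rescaled post-critical orbit `n_a = f_a^n(0) / f_a(0)`, so that `0_a = 0`, `1_a = 1`
(for `a ≠ 0`). -/
def pt (α a : ℝ) (n : ℕ) : ℝ := (f α a)^[n] 0 / f α a 0

/-- The new parameter `ā = p_{0,1}(|2_a|)`. -/
def abar (α a : ℝ) : ℝ := poincare 0 1 |pt α a 2|

/-- Symbols of the itinerary: left of, at, and right of the critical point `0`. -/
inductive Side
  | L
  | C
  | R

/-- The position of `x` relative to the critical point `0`. -/
def side (x : ℝ) : Side := if x < 0 then Side.L else if x = 0 then Side.C else Side.R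

/-- The kneading sequence of `f_a`: the itinerary of the critical value `f_a(0)`. -/
def kneading (α a : ℝ) (n : ℕ) : Side := side ((f α a)^[n + 1] 0)

/-- The parameters `a` whose kneading sequence is `RLRLRL…`. -/
def RLRL (α : ℝ) : Set ℝ :=
  {a | ∀ n, kneading α a n = if Even n then Side.R else Side.L}

/-- Ratio of consecutive intervals in the even nested family. -/
def ratioEven (α : ℝ) (n : ℕ) (a : ℝ) : ℝ :=
  |pt α a (2 * n + 4) - pt α a (2 * n + 2)| / |pt α a (2 * n + 2) - pt α a (2 * n)|

/-- Ratio of consecutive intervals in the odd nested family. -/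
def ratioOdd (α : ℝ) (n : ℕ) (a : ℝ) : ℝ :=
  |pt α a (2 * n + 5) - pt α a (2 * n + 3)| / |pt α a (2 * n + 3) - pt α a (2 * n + 1)|

end PowerLaw

end

/-!
After rescaling, the critical orbit is `y (n + 1) = 1 - t * |y n| ^ α` with `t = a ^ (α - 1)`, and
`t ∈ (1, 2)` on `RLRL α`. Let `log t` move with velocity `(2 - t) / 2`. Then
`p_{1,-1}(2_a) = log (t / (2 - t))` has velocity `1`, so the inequality between Poincaré coordinates
says that those of `n_a, (n + 2)_a, (n + 4)_a` all have velocity greater than `1`.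

Applying `x ↦ x ^ α` to three points changes the velocity of their Poincaré coordinate by multiples
of the defects `α * a ^ α / (a ^ α - c ^ α) - a / (a - c)`, which are nonnegative and monotone.
For this reason an even coordinate loses velocity along the orbit only by amounts
which telescope and add up to at most `(2 - t) / 2`, and the other coordinates lose at most
`2 - t`, whereas the coordinate of `0, |2_a|, |4_a|` starts with velocity greater than `2`.

The ratios of nested intervals are increasing functions of these coordinates. The admissible `t`
form an interval `(1, t₁)` because they are cut out by the sign of a convex function vanishing at
`1`.
-/

namespace PowerLaw

open Real Set

/-- The defect of the exponent `α` between `a` and `c`: the difference of the velocities of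
`log |a ^ α - c ^ α|` and of `log |a - c|` when `log a` moves with unit velocity and `c` is at
rest. -/
noncomputable def logDefect (α a c : ℝ) : ℝ := α * a ^ α / (a ^ α - c ^ α) - a / (a - c)

lemma mul_rpow_sub_le {α a c : ℝ} (hα : 1 ≤ α) (ha : 0 ≤ a) (hc : 0 ≤ c) :
    a * (a ^ α - c ^ α) ≤ α * a ^ α * (a - c) := by
  rcases ha.eq_or_lt with rfl | ha
  · simp [zero_rpow (by linarith : α ≠ 0)]
  have bernoulli : 1 + α * (c / a - 1) ≤ (1 + (c / a - 1)) ^ α :=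
    one_add_mul_self_le_rpow_one_add (by linarith [div_nonneg hc ha.le]) hα
  rw [add_sub_cancel, div_rpow hc ha.le, le_div_iff₀ (by positivity)] at bernoulli
  have scaled := mul_le_mul_of_nonneg_left bernoulli ha.le
  have expand : a * ((1 + α * (c / a - 1)) * a ^ α) = a * a ^ α + α * a ^ α * (c - a) := by
    field_simp
  linarith

lemma logDefect_add_swap {α a c : ℝ} (hα : α ≠ 0) (ha : 0 ≤ a) (hc : 0 ≤ c) (h : a ≠ c) :
    logDefect α a c + logDefect α c a = α - 1 := by
  have hsub : a - c ≠ 0 := sub_ne_zero.2 h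
  have hpow : a ^ α - c ^ α ≠ 0 := sub_ne_zero.2 (mt (rpow_left_inj ha hc hα).1 h)
  rw [logDefect, logDefect, ← neg_sub (a ^ α) (c ^ α), ← neg_sub a c, div_neg, div_neg]
  field_simp
  ring

lemma logDefect_nonneg {α a c : ℝ} (hα : 1 ≤ α) (ha : 0 ≤ a) (hc : 0 ≤ c) (h : a ≠ c) :
    0 ≤ logDefect α a c := by
  have bernoulli := mul_rpow_sub_le hα ha hc
  have hα0 : 0 < α := by linarith
  rw [logDefect, sub_nonneg]
  rcases h.lt_or_gt with h | h
  · have hpow : a ^ α < c ^ α := rpow_lt_rpow ha h hα0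
    rw [← neg_sub (c ^ α), ← neg_sub c, div_neg, div_neg, neg_le_neg_iff,
      div_le_div_iff₀ (by linarith) (by linarith)]
    linarith
  · have hpow : c ^ α < a ^ α := rpow_lt_rpow hc h hα0
    rw [div_le_div_iff₀ (by linarith) (by linarith)]
    linarith

lemma logDefect_le {α a c : ℝ} (hα : 1 ≤ α) (ha : 0 ≤ a) (hc : 0 ≤ c) (h : a ≠ c) :
    logDefect α a c ≤ α - 1 := by
  linarith [logDefect_add_swap (by linarith : α ≠ 0) ha hc h, logDefect_nonneg hα hc ha h.symm]

lemma logDefect_zero_right {α a : ℝ} (hα : 0 < α) (ha : 0 < a) : logDefect α a 0 = α - 1 := by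
  simp [logDefect, zero_rpow hα.ne', ha.ne', (rpow_pos_of_pos ha α).ne']

lemma mul_sinh_le_sinh_mul {α z : ℝ} (hα : 1 ≤ α) (hz : 0 ≤ z) :
    α * sinh z ≤ sinh (α * z) := by
  have hderiv (z : ℝ) : HasDerivAt (fun z => sinh (α * z) - α * sinh z)
      (cosh (α * z) * (α * 1) - α * cosh z) z :=
    ((hasDerivAt_id z).const_mul α).sinh.sub ((hasDerivAt_sinh z).const_mul α)
  have hmono : MonotoneOn (fun z => sinh (α * z) - α * sinh z) (Ici 0) := by
    refine monotoneOn_of_hasDerivWithinAt_nonneg (convex_Ici 0)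
      (fun z _ => (hderiv z).continuousAt.continuousWithinAt)
      (fun z _ => (hderiv z).hasDerivWithinAt) fun z hz => ?_
    rw [interior_Ici, mem_Ioi] at hz
    have hcosh : cosh z ≤ cosh (α * z) := by
      rw [cosh_le_cosh, abs_of_pos hz, abs_of_pos (by positivity)]
      exact le_mul_of_one_le_left hz.le hα
    linarith [mul_le_mul_of_nonneg_left hcosh (by linarith : 0 ≤ α)]
  simpa using hmono self_mem_Ici hz hz

lemma cosh_mul_sinh_mul_le {α z : ℝ} (hα : 1 ≤ α) (hz : 0 ≤ z) :
    cosh z * sinh (α * z) ≤ α * (sinh z * cosh (α * z)) := by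
  have hderiv (z : ℝ) : HasDerivAt
      (fun z => α * (sinh z * cosh (α * z)) - cosh z * sinh (α * z))
      (α * (cosh z * cosh (α * z) + sinh z * (sinh (α * z) * (α * 1)))
        - (sinh z * sinh (α * z) + cosh z * (cosh (α * z) * (α * 1)))) z :=
    (((hasDerivAt_sinh z).mul ((hasDerivAt_id z).const_mul α).cosh).const_mul α).sub
      ((hasDerivAt_cosh z).mul ((hasDerivAt_id z).const_mul α).sinh)
  have hmono : MonotoneOn
      (fun z => α * (sinh z * cosh (α * z)) - cosh z * sinh (α * z)) (Ici 0) := by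
    refine monotoneOn_of_hasDerivWithinAt_nonneg (convex_Ici 0)
      (fun z _ => (hderiv z).continuousAt.continuousWithinAt)
      (fun z _ => (hderiv z).hasDerivWithinAt) fun z hz => ?_
    rw [interior_Ici, mem_Ioi] at hz
    have hsinh : 0 ≤ sinh z * sinh (α * z) :=
      mul_nonneg (sinh_nonneg_iff.2 hz.le) (sinh_nonneg_iff.2 (by positivity))
    linarith [mul_nonneg (by nlinarith : 0 ≤ α ^ 2 - 1) hsinh]
  simpa using hmono self_mem_Ici hz hz

lemma exists_eq_exp_neg_two_mul {ρ : ℝ} (h0 : 0 < ρ) (h1 : ρ < 1) :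
    ∃ z, 0 < z ∧ ρ = exp (-(2 * z)) :=
  ⟨-log ρ / 2, by linarith [log_neg h0 h1], by rw [mul_div_cancel₀ _ two_ne_zero, neg_neg,
    exp_log h0]⟩

lemma one_sub_exp_neg_two_mul (z : ℝ) : 1 - exp (-(2 * z)) = 2 * exp (-z) * sinh z := by
  have h1 : exp (-z) * exp z = 1 := by rw [← exp_add, neg_add_cancel, exp_zero]
  have h2 : exp (-(2 * z)) = exp (-z) * exp (-z) := by rw [← exp_add]; ring_nf
  rw [sinh_eq, h2, ← h1]
  ring

lemma one_add_exp_neg_two_mul (z : ℝ) : 1 + exp (-(2 * z)) = 2 * exp (-z) * cosh z := by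
  have h1 : exp (-z) * exp z = 1 := by rw [← exp_add, neg_add_cancel, exp_zero]
  have h2 : exp (-(2 * z)) = exp (-z) * exp (-z) := by rw [← exp_add]; ring_nf
  rw [cosh_eq, h2, ← h1]
  ring

lemma sq_mul_rpow_mul_one_sub_sq_le {α ρ : ℝ} (hα : 1 ≤ α) (h0 : 0 < ρ) (h1 : ρ < 1) :
    α ^ 2 * ρ ^ (α - 1) * (1 - ρ) ^ 2 ≤ (1 - ρ ^ α) ^ 2 := by
  obtain ⟨z, hz, rfl⟩ := exists_eq_exp_neg_two_mul h0 h1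
  have hsinh : (α * sinh z) ^ 2 ≤ sinh (α * z) ^ 2 :=
    pow_le_pow_left₀ (mul_nonneg (by linarith) (sinh_nonneg_iff.2 hz.le))
      (mul_sinh_le_sinh_mul hα hz.le) 2
  have hexp : exp (-(2 * z)) ^ (α - 1) * exp (-z) ^ 2 = exp (-(α * z)) ^ 2 := by
    rw [← exp_mul, ← exp_nat_mul, ← exp_nat_mul, ← exp_add]
    push_cast
    ring_nf
  calc α ^ 2 * exp (-(2 * z)) ^ (α - 1) * (1 - exp (-(2 * z))) ^ 2
      = 4 * (exp (-(2 * z)) ^ (α - 1) * exp (-z) ^ 2) * (α * sinh z) ^ 2 := by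
        rw [one_sub_exp_neg_two_mul]; ring
    _ ≤ 4 * exp (-(α * z)) ^ 2 * sinh (α * z) ^ 2 := by rw [hexp]; gcongr
    _ = (1 - exp (-(2 * z)) ^ α) ^ 2 := by
        rw [← exp_mul, show -(2 * z) * α = -(2 * (α * z)) by ring, one_sub_exp_neg_two_mul]
        ring

lemma one_add_mul_one_sub_rpow_le {α ρ : ℝ} (hα : 1 ≤ α) (h0 : 0 < ρ) (h1 : ρ < 1) :
    (1 + ρ) * (1 - ρ ^ α) ≤ α * ((1 - ρ) * (1 + ρ ^ α)) := by
  obtain ⟨z, hz, rfl⟩ := exists_eq_exp_neg_two_mul h0 h1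
  rw [← exp_mul, show -(2 * z) * α = -(2 * (α * z)) by ring, one_sub_exp_neg_two_mul,
    one_sub_exp_neg_two_mul, one_add_exp_neg_two_mul, one_add_exp_neg_two_mul]
  have hpos : 0 ≤ 4 * (exp (-z) * exp (-(α * z))) := by positivity
  linarith [mul_le_mul_of_nonneg_left (cosh_mul_sinh_mul_le hα hz.le) hpos]

lemma logDefect_eq_ratio {α a c : ℝ} (ha : 0 < a) (hc : 0 ≤ c) :
    logDefect α a c = α / (1 - (c / a) ^ α) - 1 / (1 - c / a) := by
  rw [logDefect, div_rpow hc ha.le, one_sub_div (rpow_pos_of_pos ha α).ne', one_sub_div ha.ne',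
    div_div_eq_mul_div, div_div_eq_mul_div, one_mul]

lemma antitoneOn_logDefect_ratio {α : ℝ} (hα : 1 ≤ α) :
    AntitoneOn (fun ρ : ℝ => α / (1 - ρ ^ α) - 1 / (1 - ρ)) (Ico 0 1) := by
  have hpow {ρ : ℝ} (h : ρ ∈ Ico (0 : ℝ) 1) : 0 < 1 - ρ ^ α :=
    sub_pos.2 (rpow_lt_one h.1 h.2 (by linarith))
  have hderiv {ρ : ℝ} (h : ρ ∈ Ico (0 : ℝ) 1) :
      HasDerivAt (fun ρ : ℝ => α / (1 - ρ ^ α) - 1 / (1 - ρ))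
        ((0 * (1 - ρ ^ α) - α * (-(α * ρ ^ (α - 1)))) / (1 - ρ ^ α) ^ 2
          - (0 * (1 - ρ) - 1 * (-1)) / (1 - ρ) ^ 2) ρ :=
    ((hasDerivAt_const ρ α).div ((hasDerivAt_rpow_const (Or.inr hα)).const_sub 1)
      (hpow h).ne').sub ((hasDerivAt_const ρ (1 : ℝ)).div ((hasDerivAt_id ρ).const_sub 1)
        (sub_ne_zero.2 h.2.ne'))
  refine antitoneOn_of_hasDerivWithinAt_nonpos (convex_Ico 0 1)
    (fun ρ hρ => (hderiv hρ).continuousAt.continuousWithinAt)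
    (fun ρ hρ => (hderiv (interior_subset hρ)).hasDerivWithinAt) fun ρ hρ => ?_
  rw [interior_Ico] at hρ
  have hpos : 0 < 1 - ρ := sub_pos.2 hρ.2
  have hpos' : 0 < 1 - ρ ^ α := hpow ⟨hρ.1.le, hρ.2⟩
  rw [sub_nonpos, div_le_div_iff₀ (by positivity) (by positivity)]
  linarith [sq_mul_rpow_mul_one_sub_sq_le hα hρ.1 hρ.2]

lemma logDefect_anti_right {α a c c' : ℝ} (hα : 1 ≤ α) (hc : 0 ≤ c) (h : c ≤ c') (h' : c' < a) :
    logDefect α a c' ≤ logDefect α a c := by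
  have ha : 0 < a := by linarith
  rw [logDefect_eq_ratio ha hc, logDefect_eq_ratio ha (hc.trans h)]
  refine antitoneOn_logDefect_ratio hα ⟨by positivity, ?_⟩ ⟨div_nonneg (hc.trans h) ha.le, ?_⟩
    (by gcongr)
  · rw [div_lt_one ha]; linarith
  · rwa [div_lt_one ha]

lemma logDefect_anti_right_above {α a c c' : ℝ} (hα : 1 ≤ α) (ha : 0 < a) (h : a < c)
    (h' : c ≤ c') : logDefect α a c' ≤ logDefect α a c := by
  have hα0 : α ≠ 0 := by linarith
  have hc : 0 < c := ha.trans h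
  have hc' : 0 < c' := hc.trans_le h'
  suffices logDefect α c a ≤ logDefect α c' a by
    linarith [logDefect_add_swap hα0 ha.le hc.le h.ne,
      logDefect_add_swap hα0 ha.le hc'.le (h.trans_le h').ne]
  rw [logDefect_eq_ratio hc ha.le, logDefect_eq_ratio hc' ha.le]
  refine antitoneOn_logDefect_ratio hα ⟨by positivity, ?_⟩ ⟨by positivity, ?_⟩ (by gcongr)
  · rw [div_lt_one hc']; linarith
  · rwa [div_lt_one hc]

lemma half_le_logDefect {α a c : ℝ} (hα : 1 ≤ α) (hc : 0 ≤ c) (h : c < a) :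
    (α - 1) / 2 ≤ logDefect α a c := by
  have ha : 0 < a := by linarith
  rcases hc.eq_or_lt with rfl | hc
  · rw [logDefect_zero_right (by linarith) ha]
    linarith
  have hρ0 : 0 < c / a := by positivity
  have hρ1 : c / a < 1 := (div_lt_one ha).2 h
  have hsub : 0 < 1 - c / a := sub_pos.2 hρ1
  have hpow : 0 < 1 - (c / a) ^ α := sub_pos.2 (rpow_lt_one hρ0.le hρ1 (by linarith))
  rw [logDefect_eq_ratio ha hc.le, div_sub_div _ _ hpow.ne' hsub.ne',
    div_le_div_iff₀ two_pos (by positivity)]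
  linarith [one_add_mul_one_sub_rpow_le hα hρ0 hρ1]

lemma logDefect_le_of_lt_of_lt {α a b c : ℝ} (hα : 1 ≤ α) (ha : 0 ≤ a) (h : a < c) (h' : c < b) :
    logDefect α a c ≤ logDefect α b c := by
  have hc : 0 ≤ c := ha.trans h.le
  linarith [logDefect_add_swap (by linarith : α ≠ 0) ha hc h.ne, half_le_logDefect hα ha h,
    half_le_logDefect hα hc h']

lemma rpow_bound_of_le {α t b s : ℝ} (hα : 0 ≤ α) (ht : 0 ≤ t)
    (hb : (α + 1) * (t * b ^ α) ≤ 1) (hs : s ∈ Icc 0 b) : (α + 1) * (t * s ^ α) ≤ 1 :=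
  le_trans (by gcongr; exacts [hs.1, hs.2]) hb

lemma one_sub_mul_rpow_pos {α t b s : ℝ} (hα : 0 < α) (ht : 0 ≤ t)
    (hb : (α + 1) * (t * b ^ α) ≤ 1) (hs : s ∈ Icc 0 b) : 0 < 1 - t * s ^ α := by
  have hbound := rpow_bound_of_le hα.le ht hb hs
  nlinarith [mul_nonneg ht (rpow_nonneg hs.1 α)]

lemma monotoneOn_mul_one_sub_mul_rpow {α t b : ℝ} (hα : 1 ≤ α) (ht : 0 ≤ t)
    (hb : (α + 1) * (t * b ^ α) ≤ 1) : MonotoneOn (fun s => s * (1 - t * s ^ α)) (Icc 0 b) := by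
  have hderiv (s : ℝ) : HasDerivAt (fun s => s * (1 - t * s ^ α))
      (1 * (1 - t * s ^ α) + s * -(t * (α * s ^ (α - 1)))) s :=
    (hasDerivAt_id s).mul (((hasDerivAt_rpow_const (Or.inr hα)).const_mul t).const_sub 1)
  refine monotoneOn_of_hasDerivWithinAt_nonneg (convex_Icc 0 b)
    (fun s _ => (hderiv s).continuousAt.continuousWithinAt)
    (fun s _ => (hderiv s).hasDerivWithinAt) fun s hs => ?_
  have hbound := rpow_bound_of_le (by linarith) ht hb (interior_subset hs)
  rw [interior_Icc] at hs
  have hpow : s * s ^ (α - 1) = s ^ α := by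
    rw [rpow_sub_one hs.1.ne', mul_div_cancel₀ _ hs.1.ne']
  linear_combination hbound + α * t * hpow

lemma hasDerivAt_mul_one_sub_mul_rpow_rpow {α t s : ℝ} (hα : 1 ≤ α) (hs : 0 ≤ s)
    (hpos : 0 < 1 - t * s ^ α) : HasDerivAt (fun s => t * (1 - t * s ^ α) ^ α)
      (-(α ^ 2 * t ^ 2 * (s * (1 - t * s ^ α)) ^ (α - 1))) s := by
  refine (((((hasDerivAt_rpow_const (Or.inr hα)).const_mul t).const_sub 1).rpow_const
    (Or.inl hpos.ne')).const_mul t).congr_deriv ?_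
  rw [mul_rpow hs hpos.le]
  ring

lemma concaveOn_mul_one_sub_mul_rpow_rpow {α t b : ℝ} (hα : 1 ≤ α) (ht : 0 ≤ t)
    (hb : (α + 1) * (t * b ^ α) ≤ 1) :
    ConcaveOn ℝ (Icc 0 b) (fun s => t * (1 - t * s ^ α) ^ α) := by
  have hpos {s : ℝ} (hs : s ∈ Icc 0 b) := one_sub_mul_rpow_pos (by linarith : 0 < α) ht hb hs
  have hderiv {s : ℝ} (hs : s ∈ Icc 0 b) :=
    hasDerivAt_mul_one_sub_mul_rpow_rpow hα hs.1 (hpos hs)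
  refine AntitoneOn.concaveOn_of_deriv (convex_Icc 0 b)
    (fun s hs => (hderiv hs).continuousAt.continuousWithinAt)
    (fun s hs => (hderiv (interior_subset hs)).differentiableAt.differentiableWithinAt)
    fun u hu v hv huv => ?_
  replace hu := interior_subset hu
  replace hv := interior_subset hv
  rw [(hderiv hu).deriv, (hderiv hv).deriv]
  have hmono := monotoneOn_mul_one_sub_mul_rpow hα ht hb hu hv huv
  have hbase := mul_nonneg hu.1 (hpos hu).le
  gcongr

lemma concaveOn_le_tangent {g : ℝ → ℝ} {S : Set ℝ} {g' u v : ℝ} (hg : ConcaveOn ℝ S g)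
    (hu : u ∈ S) (hv : v ∈ S) (hderiv : HasDerivAt g g' u) : g v ≤ g u + g' * (v - u) := by
  rcases lt_trichotomy u v with h | rfl | h
  · have hslope := hg.slope_le_of_hasDerivAt hu hv h hderiv
    rw [slope_def_field, div_le_iff₀ (by linarith)] at hslope
    linarith
  · simp
  · have hslope := hg.le_slope_of_hasDerivAt hv hu h hderiv
    rw [slope_def_field, le_div_iff₀ (by linarith)] at hslope
    linarith

/-- Minus the logarithmic derivative of `1 - t * u ^ α` with respect to `log (t * u ^ α)`. -/
noncomputable def zeta (α t u : ℝ) : ℝ := t * u ^ α / (1 - t * u ^ α)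

lemma zeta_mul_le_tangent {α t b u v : ℝ} (hα : 1 ≤ α) (ht : 0 ≤ t)
    (hb : (α + 1) * (t * b ^ α) ≤ 1) (hu : u ∈ Icc 0 b) (hv : v ∈ Icc 0 b) :
    α ^ 2 * zeta α t u * (t * (1 - t * u ^ α) ^ α) * (v - u) ≤
      u * (t * (1 - t * u ^ α) ^ α - t * (1 - t * v ^ α) ^ α) := by
  rcases hu.1.eq_or_lt with rfl | hu0
  · simp [zeta, zero_rpow (by linarith : α ≠ 0)]
  have hpos := one_sub_mul_rpow_pos (by linarith) ht hb hu
  have htangent := concaveOn_le_tangent (concaveOn_mul_one_sub_mul_rpow_rpow hα ht hb) hu hv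
    (hasDerivAt_mul_one_sub_mul_rpow_rpow hα hu.1 hpos)
  have hslope : α ^ 2 * zeta α t u * (t * (1 - t * u ^ α) ^ α) =
      u * (α ^ 2 * t ^ 2 * (u * (1 - t * u ^ α)) ^ (α - 1)) := by
    rw [zeta, mul_rpow hu.1 hpos.le, rpow_sub_one hu0.ne', rpow_sub_one hpos.ne']
    field_simp
  rw [hslope]
  linarith [mul_le_mul_of_nonneg_left htangent hu.1]

lemma succ_mul_le_one {α t d : ℝ} (hα : 1 ≤ α) (ht : t ≤ 2) (hd : d ≤ 1)
    (h : 1 < t * (1 - d) ^ α) : (α + 1) * d ≤ 1 := by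
  by_contra! hc
  have hα0 : 0 < α := by linarith
  have bernoulli : 1 + α * (1 / α) ≤ (1 + 1 / α) ^ α :=
    one_add_mul_self_le_rpow_one_add (by linarith [one_div_pos.2 hα0]) hα
  have hprod : (1 - d) * (1 + 1 / α) ≤ 1 := by
    field_simp
    linarith
  have hpow : (1 - d) ^ α * (1 + 1 / α) ^ α ≤ 1 := by
    rw [← mul_rpow (sub_nonneg.2 hd) (by positivity)]
    exact rpow_le_one (mul_nonneg (sub_nonneg.2 hd) (by positivity)) hprod hα0.le
  rw [mul_one_div_cancel hα0.ne'] at bernoulli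
  have hnonneg : 0 ≤ (1 - d) ^ α := rpow_nonneg (sub_nonneg.2 hd) α
  linarith [mul_le_mul_of_nonneg_left bernoulli hnonneg, mul_le_mul_of_nonneg_right ht hnonneg]

/-- The absolute values `e j = |y (2 j)|` and `o j = y (2 j + 1)` of a critical orbit
`y (n + 1) = 1 - t * |y n| ^ α` with kneading sequence `RLRL…`. -/
structure CriticalOrbit (α t : ℝ) (e o : ℕ → ℝ) : Prop where
  one_lt_exp : 1 < α
  one_lt : 1 < t
  e_zero : e 0 = 0
  o_eq : ∀ j, o j = 1 - t * e j ^ α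
  e_succ : ∀ j, e (j + 1) = t * o j ^ α - 1
  o_pos : ∀ j, 0 < o j
  e_succ_pos : ∀ j, 0 < e (j + 1)

namespace CriticalOrbit

variable {α t : ℝ} {e o : ℕ → ℝ}

lemma exp_pos (H : CriticalOrbit α t e o) : 0 < α := zero_lt_one.trans H.one_lt_exp

lemma param_pos (H : CriticalOrbit α t e o) : 0 < t := zero_lt_one.trans H.one_lt

lemma e_nonneg (H : CriticalOrbit α t e o) (j : ℕ) : 0 ≤ e j := by
  cases j with
  | zero => exact H.e_zero.ge
  | succ j => exact (H.e_succ_pos j).le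

lemma o_zero (H : CriticalOrbit α t e o) : o 0 = 1 := by
  rw [H.o_eq, H.e_zero, zero_rpow H.exp_pos.ne', mul_zero, sub_zero]

lemma e_one (H : CriticalOrbit α t e o) : e 1 = t - 1 := by
  rw [H.e_succ, H.o_zero, one_rpow, mul_one]

lemma o_lt (H : CriticalOrbit α t e o) {i k : ℕ} (h : e i < e k) : o k < o i := by
  rw [H.o_eq, H.o_eq]
  linarith [mul_lt_mul_of_pos_left (rpow_lt_rpow (H.e_nonneg i) h H.exp_pos) H.param_pos]

lemma e_succ_lt (H : CriticalOrbit α t e o) {i k : ℕ} (h : e i < e k) :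
    e (k + 1) < e (i + 1) := by
  rw [H.e_succ, H.e_succ]
  linarith [mul_lt_mul_of_pos_left (rpow_lt_rpow (H.o_pos k).le (H.o_lt h) H.exp_pos)
    H.param_pos]

lemma o_le_one (H : CriticalOrbit α t e o) (j : ℕ) : o j ≤ 1 := by
  rw [H.o_eq]
  linarith [mul_nonneg H.param_pos.le (rpow_nonneg (H.e_nonneg j) α)]

lemma e_le (H : CriticalOrbit α t e o) (j : ℕ) : e j ≤ t - 1 := by
  cases j with
  | zero => linarith [H.e_zero, H.one_lt]
  | succ j =>
    have hpow : o j ^ α ≤ 1 := rpow_le_one (H.o_pos j).le (H.o_le_one j) H.exp_pos.le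
    rw [H.e_succ]
    linarith [mul_le_mul_of_nonneg_left hpow H.param_pos.le]

lemma e_mem (H : CriticalOrbit α t e o) (j : ℕ) : e j ∈ Icc 0 (t - 1) := ⟨H.e_nonneg j, H.e_le j⟩

lemma lt_two (H : CriticalOrbit α t e o) : t < 2 := by
  by_contra! h
  have hpos : 0 < 1 - t * (t - 1) ^ α := by
    rw [← H.e_one, ← H.o_eq]
    exact H.o_pos 1
  have hpow : 1 ≤ (t - 1) ^ α := one_le_rpow (by linarith) H.exp_pos.le
  linarith [mul_le_mul_of_nonneg_left hpow H.param_pos.le]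

lemma lt_of_even (H : CriticalOrbit α t e o) {j : ℕ} (hj : Even j) :
    e j < e (j + 2) ∧ e (j + 2) < e (j + 1) := by
  obtain ⟨m, rfl⟩ := hj
  induction m with
  | zero =>
    have h01 : e 0 < e 1 := H.e_zero.trans_lt (H.e_succ_pos 0)
    exact ⟨H.e_zero.trans_lt (H.e_succ_pos 1), H.e_succ_lt h01⟩
  | succ m ih =>
    rw [show m + 1 + (m + 1) = m + m + 2 by ring]
    exact ⟨H.e_succ_lt (H.e_succ_lt ih.1), H.e_succ_lt (H.e_succ_lt ih.2)⟩

lemma lt_add_three_of_even (H : CriticalOrbit α t e o) {j : ℕ} (hj : Even j) :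
    e (j + 2) < e (j + 3) ∧ e (j + 3) < e (j + 1) :=
  ⟨H.e_succ_lt (H.lt_of_even hj).2, H.e_succ_lt (H.lt_of_even hj).1⟩

lemma lt_succ_of_even (H : CriticalOrbit α t e o) {j : ℕ} (hj : Even j) : e j < e (j + 1) :=
  (H.lt_of_even hj).1.trans (H.lt_of_even hj).2

lemma e_between (H : CriticalOrbit α t e o) (j : ℕ) :
    e j < e (j + 2) ∧ e (j + 2) < e (j + 1) ∨ e (j + 1) < e (j + 2) ∧ e (j + 2) < e j := by
  rcases Nat.even_or_odd j with h | ⟨m, rfl⟩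
  · exact Or.inl (H.lt_of_even h)
  · exact Or.inr (H.lt_add_three_of_even (even_two_mul m))

lemma o_between (H : CriticalOrbit α t e o) (j : ℕ) :
    o j < o (j + 2) ∧ o (j + 2) < o (j + 1) ∨ o (j + 1) < o (j + 2) ∧ o (j + 2) < o j :=
  (H.e_between j).symm.imp (fun h => ⟨H.o_lt h.2, H.o_lt h.1⟩) fun h => ⟨H.o_lt h.2, H.o_lt h.1⟩

lemma e_ne_add_two (H : CriticalOrbit α t e o) (j : ℕ) : e j ≠ e (j + 2) :=
  (H.e_between j).elim (fun h => h.1.ne) fun h => h.2.ne'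

lemma e_ne_succ (H : CriticalOrbit α t e o) (j : ℕ) : e (j + 1) ≠ e (j + 2) :=
  (H.e_between j).elim (fun h => h.2.ne') fun h => h.1.ne

lemma o_ne (H : CriticalOrbit α t e o) {i k : ℕ} (h : e i ≠ e k) : o i ≠ o k :=
  h.lt_or_gt.elim (fun h => (H.o_lt h).ne') fun h => (H.o_lt h).ne

lemma succ_mul_le (H : CriticalOrbit α t e o) : (α + 1) * (t * (t - 1) ^ α) ≤ 1 := by
  have ho : 0 < 1 - t * (t - 1) ^ α := by
    rw [← H.e_one, ← H.o_eq]
    exact H.o_pos 1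
  have he : 0 < t * (1 - t * (t - 1) ^ α) ^ α - 1 := by
    rw [← H.e_one, ← H.o_eq, ← H.e_succ]
    exact H.e_succ_pos 1
  exact succ_mul_le_one H.one_lt_exp.le H.lt_two.le (by linarith) (by linarith)

lemma zeta_eq (H : CriticalOrbit α t e o) (j : ℕ) : zeta α t (e j) = t * e j ^ α / o j := by
  rw [zeta, H.o_eq]

lemma zeta_zero (H : CriticalOrbit α t e o) : zeta α t (e 0) = 0 := by
  rw [zeta, H.e_zero, zero_rpow H.exp_pos.ne', mul_zero, zero_div]

lemma zeta_nonneg (H : CriticalOrbit α t e o) (j : ℕ) : 0 ≤ zeta α t (e j) := by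
  rw [H.zeta_eq]
  exact div_nonneg (mul_nonneg H.param_pos.le (rpow_nonneg (H.e_nonneg j) α)) (H.o_pos j).le

lemma zeta_pos (H : CriticalOrbit α t e o) (j : ℕ) : 0 < zeta α t (e (j + 1)) := by
  rw [H.zeta_eq]
  exact div_pos (mul_pos H.param_pos (rpow_pos_of_pos (H.e_succ_pos j) α)) (H.o_pos _)

lemma zeta_eq_one_div_sub_one (H : CriticalOrbit α t e o) (j : ℕ) :
    zeta α t (e j) = 1 / o j - 1 := by
  rw [H.zeta_eq, div_sub_one (H.o_pos j).ne', H.o_eq]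
  ring

lemma zeta_lt (H : CriticalOrbit α t e o) {i k : ℕ} (h : e i < e k) :
    zeta α t (e i) < zeta α t (e k) := by
  rw [H.zeta_eq_one_div_sub_one, H.zeta_eq_one_div_sub_one]
  linarith [one_div_lt_one_div_of_lt (H.o_pos k) (H.o_lt h)]

lemma zeta_mul_le (H : CriticalOrbit α t e o) (i k : ℕ) :
    α ^ 2 * zeta α t (e i) * (1 + e (i + 1)) * (e k - e i) ≤ e i * (e (i + 1) - e (k + 1)) := by
  have htangent := zeta_mul_le_tangent H.one_lt_exp.le H.param_pos.le H.succ_mul_le (H.e_mem i)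
    (H.e_mem k)
  rw [← H.o_eq, ← H.o_eq] at htangent
  rw [H.e_succ, H.e_succ]
  linarith

lemma logDefect_e_nonneg (H : CriticalOrbit α t e o) {i k : ℕ} (h : e i ≠ e k) :
    0 ≤ logDefect α (e i) (e k) :=
  logDefect_nonneg H.one_lt_exp.le (H.e_nonneg i) (H.e_nonneg k) h

lemma logDefect_o_nonneg (H : CriticalOrbit α t e o) {i k : ℕ} (h : e i ≠ e k) :
    0 ≤ logDefect α (o i) (o k) :=
  logDefect_nonneg H.one_lt_exp.le (H.o_pos i).le (H.o_pos k).le (H.o_ne h)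

lemma logDefect_o_le (H : CriticalOrbit α t e o) {i k : ℕ} (h : e i ≠ e k) :
    logDefect α (o i) (o k) ≤ α - 1 :=
  logDefect_le H.one_lt_exp.le (H.o_pos i).le (H.o_pos k).le (H.o_ne h)

lemma logDefect_e_le_div (H : CriticalOrbit α t e o) {i k : ℕ} (h : e i < e k) :
    logDefect α (e i) (e k) ≤ e i / (e k - e i) := by
  have hpow : e i ^ α < e k ^ α := rpow_lt_rpow (H.e_nonneg i) h H.exp_pos
  have hneg : α * e i ^ α / (e i ^ α - e k ^ α) ≤ 0 :=
    div_nonpos_of_nonneg_of_nonpos (mul_nonneg H.exp_pos.le (rpow_nonneg (H.e_nonneg i) α))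
      (by linarith)
  rw [logDefect, ← neg_sub (e k) (e i), div_neg]
  linarith

end CriticalOrbit

/-- The analogue of `logDefect` for the second iterate, which carries `e j` to `e (j + 1)` by way
of `o j`. -/
noncomputable def iterDefect (α t : ℝ) (e o : ℕ → ℝ) (i k : ℕ) : ℝ :=
  logDefect α (e i) (e k) - α * zeta α t (e i) * logDefect α (o i) (o k)

namespace CriticalOrbit

variable {α t : ℝ} {e o : ℕ → ℝ}

lemma iterDefect_eq (H : CriticalOrbit α t e o) {i k : ℕ} (h : e i ≠ e k) :
    iterDefect α t e o i k =
      e i / (e k - e i) - α ^ 2 * zeta α t (e i) * (1 + e (i + 1)) / (e (i + 1) - e (k + 1)) := by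
  have hα := H.exp_pos.ne'
  have ht := H.param_pos.ne'
  have hoi := (H.o_pos i).ne'
  have hepow : e i ^ α - e k ^ α ≠ 0 :=
    sub_ne_zero.2 (mt (rpow_left_inj (H.e_nonneg i) (H.e_nonneg k) hα).1 h)
  have hopow : o i ^ α - o k ^ α ≠ 0 :=
    sub_ne_zero.2 (mt (rpow_left_inj (H.o_pos i).le (H.o_pos k).le hα).1 (H.o_ne h))
  have he := sub_ne_zero.2 h
  have ho : o i - o k = t * -(e i ^ α - e k ^ α) := by rw [H.o_eq, H.o_eq]; ring
  have hesucc : e (i + 1) - e (k + 1) = t * (o i ^ α - o k ^ α) := by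
    rw [H.e_succ, H.e_succ]; ring
  have hone : 1 + e (i + 1) = t * o i ^ α := by rw [H.e_succ]; ring
  rw [iterDefect, logDefect, logDefect, ho, hesucc, hone, H.zeta_eq, ← neg_sub (e i) (e k)]
  field_simp
  ring

lemma iterDefect_nonneg (H : CriticalOrbit α t e o) {i k : ℕ} (h : e i ≠ e k) :
    0 ≤ iterDefect α t e o i k := by
  have htangent := H.zeta_mul_le i k
  rw [H.iterDefect_eq h, sub_nonneg]
  rcases h.lt_or_gt with h | h
  · have hsucc := H.e_succ_lt h
    rw [div_le_div_iff₀ (by linarith) (by linarith)]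
    exact htangent
  · have hsucc := H.e_succ_lt h
    rw [← neg_sub (e i), ← neg_sub (e (k + 1)), div_neg, div_neg, neg_le_neg_iff,
      div_le_div_iff₀ (by linarith) (by linarith)]
    linarith

lemma iterDefect_le_div (H : CriticalOrbit α t e o) {i k : ℕ} (h : e i < e k) :
    iterDefect α t e o i k ≤ e i / (e k - e i) := by
  have hterm : 0 ≤ α * zeta α t (e i) * logDefect α (o i) (o k) :=
    mul_nonneg (mul_nonneg H.exp_pos.le (H.zeta_nonneg i)) (H.logDefect_o_nonneg h.ne)
  rw [iterDefect]
  linarith [H.logDefect_e_le_div h]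

end CriticalOrbit

/-- The velocity of `log |a i / a k - 1|` when `log a` moves with velocity `l`. -/
noncomputable def sepVel (a l : ℕ → ℝ) (i k : ℕ) : ℝ := a i * (l i - l k) / (a i - a k)

/-- The velocity of the Poincaré coordinate `poincare (a (j + 1)) (a j) (a (j + 2))` of three
consecutive terms when `log a` moves with velocity `l`. -/
noncomputable def vel (a l : ℕ → ℝ) (j : ℕ) : ℝ := sepVel a l (j + 1) (j + 2) - sepVel a l j (j + 2)

section sepVel

variable {a l : ℕ → ℝ} {i j k : ℕ}

lemma le_of_sepVel_nonneg (hi : 0 < a i) (h : a k < a i) (hnonneg : 0 ≤ sepVel a l i k) :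
    l k ≤ l i := by
  by_contra! hlt
  have hneg : sepVel a l i k < 0 :=
    div_neg_of_neg_of_pos (mul_neg_of_pos_of_neg hi (by linarith)) (by linarith)
  linarith

lemma sub_eq_one_sub_div_mul_sepVel (hi : a i ≠ 0) (h : a i ≠ a k) :
    l i - l k = (1 - a k / a i) * sepVel a l i k := by
  have hsub := sub_ne_zero.2 h
  rw [sepVel]
  field_simp

lemma sepVel_succ_eq (h0 : a (j + 2) ≠ 0) (h : a j ≠ a (j + 2)) :
    sepVel a l (j + 1) (j + 2) = vel a l j + a j / a (j + 2) * sepVel a l (j + 2) j := by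
  have hsub := sub_ne_zero.2 h
  rw [vel, sepVel, sepVel, sepVel, ← neg_sub (a j) (a (j + 2)), div_neg]
  field_simp
  ring

lemma sepVel_succ_self_eq (h02 : a j ≠ a (j + 2)) (h12 : a (j + 1) ≠ a (j + 2))
    (h01 : a j ≠ a (j + 1)) :
    sepVel a l (j + 1) j =
      sepVel a l (j + 2) j + (a (j + 1) - a (j + 2)) / (a (j + 1) - a j) * vel a l j := by
  have hsub02 := sub_ne_zero.2 h02.symm
  have hsub12 := sub_ne_zero.2 h12
  have hsub01 := sub_ne_zero.2 h01.symm
  rw [vel, sepVel, sepVel, sepVel, sepVel, ← neg_sub (a (j + 2)) (a j), div_neg]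
  field_simp
  ring

lemma sepVel_add_two_succ_eq (h02 : a j ≠ a (j + 2)) (h12 : a (j + 1) ≠ a (j + 2))
    (h01 : a j ≠ a (j + 1)) :
    sepVel a l (j + 2) (j + 1) =
      sepVel a l j (j + 1) + (a j - a (j + 2)) / (a j - a (j + 1)) * vel a l j := by
  have hsub02 := sub_ne_zero.2 h02
  have hsub12 := sub_ne_zero.2 h12
  have hsub01 := sub_ne_zero.2 h01
  rw [vel, sepVel, sepVel, sepVel, sepVel, ← neg_sub (a (j + 1)) (a (j + 2)), div_neg]
  field_simp
  ring

lemma one_add_mul_sepVel_succ_add (h0 : a (j + 2) ≠ 0) (h : a j ≠ a (j + 2)) :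
    (1 + a (j + 2)) * sepVel a l (j + 1) (j + 2) + l (j + 2) =
      (1 + a (j + 2)) * vel a l j + (1 + a j) * sepVel a l (j + 2) j + l j := by
  have hl := sub_eq_one_sub_div_mul_sepVel (l := l) h0 h.symm
  rw [sepVel_succ_eq h0 h, eq_add_of_sub_eq hl]
  field_simp
  ring

lemma le_vel_add_mul_sepVel (h1 : a j < a (j + 2)) (h2 : a (j + 2) < a (j + 1)) {κ m : ℝ}
    (hvel : 0 ≤ vel a l j) (hκ0 : 0 ≤ κ) (hκ1 : κ ≤ 1) (hm : m ≤ vel a l j)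
    (hm' : m ≤ sepVel a l (j + 1) j) : m ≤ vel a l j + κ * sepVel a l (j + 2) j := by
  have hpair := sepVel_succ_self_eq (l := l) h1.ne h2.ne' (h1.trans h2).ne
  have hr : (a (j + 1) - a (j + 2)) / (a (j + 1) - a j) ≤ 1 :=
    div_le_one_of_le₀ (by linarith) (by linarith)
  nlinarith [mul_nonneg (sub_nonneg.2 hκ1) (sub_nonneg.2 hm), mul_nonneg hκ0 (sub_nonneg.2 hm'),
    mul_nonneg hκ0 (mul_nonneg (sub_nonneg.2 hr) hvel)]

lemma le_vel_add_mul_sub (h0 : 0 < a (j + 2)) (h1 : a j < a (j + 2)) (h2 : a (j + 2) < a (j + 1))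
    {K m : ℝ} (hvel : 0 ≤ vel a l j) (hK : 0 ≤ K) (hK' : K * (a (j + 2) - a j) ≤ a (j + 2))
    (hm : m ≤ vel a l j) (hm' : m ≤ sepVel a l (j + 1) j) :
    m ≤ vel a l j + K * (l (j + 2) - l j) := by
  rw [sub_eq_one_sub_div_mul_sepVel h0.ne' h1.ne', one_sub_div h0.ne', ← mul_assoc,
    ← mul_div_assoc]
  exact le_vel_add_mul_sepVel h1 h2 hvel (div_nonneg (mul_nonneg hK (by linarith)) h0.le)
    (div_le_one_of_le₀ hK' h0.le) hm hm'

lemma le_sepVel_succ (h0 : 0 ≤ a j) (h1 : a j < a (j + 2)) (h2 : a (j + 2) < a (j + 1)) {m : ℝ}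
    (hvel : 0 ≤ vel a l j) (hm : m ≤ vel a l j) (hm' : m ≤ sepVel a l (j + 1) j) :
    m ≤ sepVel a l (j + 1) (j + 2) := by
  have hpos : 0 < a (j + 2) := h0.trans_lt h1
  rw [sepVel_succ_eq hpos.ne' h1.ne]
  exact le_vel_add_mul_sepVel h1 h2 hvel (div_nonneg h0 hpos.le)
    (div_le_one_of_le₀ h1.le hpos.le) hm hm'

lemma sepVel_add_le_sepVel_succ_add (h0 : 0 < a (j + 2)) (h1 : a j < a (j + 2))
    (h2 : a (j + 2) < a (j + 1)) (hvel : 0 ≤ vel a l j) :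
    sepVel a l (j + 1) j + l j ≤ sepVel a l (j + 1) (j + 2) + l (j + 2) := by
  have hr : (a (j + 1) - a (j + 2)) / (a (j + 1) - a j) ≤ 1 :=
    div_le_one_of_le₀ (by linarith) (by linarith)
  rw [sepVel_succ_self_eq h1.ne h2.ne' (h1.trans h2).ne, sepVel_succ_eq h0.ne' h1.ne]
  linarith [sub_eq_one_sub_div_mul_sepVel (l := l) h0.ne' h1.ne',
    mul_le_mul_of_nonneg_right hr hvel]

lemma sepVel_rpow {α c d τ : ℝ} {b m : ℕ → ℝ} (hα : α ≠ 0) (hc : c ≠ 0) (ha : ∀ i, 0 ≤ a i)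
    (hb : ∀ i, b i = c * a i ^ α + d) (hm : ∀ i, b i * m i = c * a i ^ α * (α * l i + τ))
    (h : a i ≠ a k) :
    sepVel b m i k =
      sepVel a l i k + logDefect α (a i) (a k) * (l i - l k) + (α * l k + τ - m k) := by
  have hpow : a i ^ α - a k ^ α ≠ 0 := sub_ne_zero.2 (mt (rpow_left_inj (ha i) (ha k) hα).1 h)
  have hsub : b i - b k = c * (a i ^ α - a k ^ α) := by rw [hb, hb]; ring
  have hnum : b i * (m i - m k) =
      c * a i ^ α * (α * (l i - l k)) + (b i - b k) * (α * l k + τ - m k) := by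
    linear_combination hm i - hm k - (α * l k + τ) * hsub
  rw [sepVel, sepVel, logDefect, hnum, hsub]
  field_simp
  ring

lemma vel_rpow {α c d τ : ℝ} {b m : ℕ → ℝ} (hα : α ≠ 0) (hc : c ≠ 0) (ha : ∀ i, 0 ≤ a i)
    (hb : ∀ i, b i = c * a i ^ α + d) (hm : ∀ i, b i * m i = c * a i ^ α * (α * l i + τ))
    (h02 : a j ≠ a (j + 2)) (h12 : a (j + 1) ≠ a (j + 2)) :
    vel b m j = vel a l j + logDefect α (a (j + 1)) (a (j + 2)) * (l (j + 1) - l (j + 2)) +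
      logDefect α (a j) (a (j + 2)) * (l (j + 2) - l j) := by
  rw [vel, vel, sepVel_rpow hα hc ha hb hm h12, sepVel_rpow hα hc ha hb hm h02]
  ring

end sepVel

/-- Logarithmic velocities `l` of `e` and `L` of `o` along a critical orbit, with the parameter
moving so that `t' = t * (2 - t) / 2`. Since `e 0 = 0` has no logarithmic velocity, `l 0` is a
convention, chosen so that `sepVel e l 1 0 = vel e l 0`. -/
structure LogVelocity (α t : ℝ) (e o l L : ℕ → ℝ) : Prop extends CriticalOrbit α t e o where
  L_eq : ∀ j, L j = -(zeta α t (e j) * (α * l j + (2 - t) / 2))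
  l_succ : ∀ j, e (j + 1) * l (j + 1) = (1 + e (j + 1)) * ((2 - t) / 2 + α * L j)
  l_zero : l 0 = l 1 - vel e l 0

namespace LogVelocity

variable {α t : ℝ} {e o l L : ℕ → ℝ} {j : ℕ}

lemma vel_o_eq (H : LogVelocity α t e o l L) (j : ℕ) :
    vel o L j = vel e l j + logDefect α (e (j + 1)) (e (j + 2)) * (l (j + 1) - l (j + 2)) +
      logDefect α (e j) (e (j + 2)) * (l (j + 2) - l j) := by
  refine vel_rpow (d := 1) (τ := (2 - t) / 2) H.exp_pos.ne' (neg_ne_zero.2 H.param_pos.ne')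
    H.e_nonneg (fun i => ?_) (fun i => ?_) (H.e_ne_add_two j) (H.e_ne_succ j)
  · exact (H.o_eq i).trans (by ring)
  · have ho := (H.o_pos i).ne'
    rw [H.L_eq, H.zeta_eq]
    field_simp

lemma vel_e_succ_eq (H : LogVelocity α t e o l L) (j : ℕ) :
    vel e l (j + 1) = vel o L j +
      logDefect α (o (j + 1)) (o (j + 2)) * (L (j + 1) - L (j + 2)) +
      logDefect α (o j) (o (j + 2)) * (L (j + 2) - L j) := by
  refine vel_rpow (b := fun i => e (i + 1)) (m := fun i => l (i + 1)) (τ := (2 - t) / 2)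
    H.exp_pos.ne' H.param_pos.ne' (fun i => (H.o_pos i).le) (fun i => H.e_succ i) (fun i => ?_)
    (H.o_ne (H.e_ne_add_two j)) (H.o_ne (H.e_ne_succ j))
  rw [H.l_succ, H.e_succ]
  ring

lemma L_sub_eq (H : LogVelocity α t e o l L) (i k : ℕ) :
    L k - L i = -((zeta α t (e k) - zeta α t (e i)) * (α * l k + (2 - t) / 2)) -
      α * zeta α t (e i) * (l k - l i) := by
  rw [H.L_eq, H.L_eq]
  ring

lemma mul_L_sub (H : LogVelocity α t e o l L) {i k : ℕ} (h : e (i + 1) ≠ e (k + 1)) :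
    α * (L k - L i) = (e (k + 1) - e (i + 1)) *
      ((1 + e (i + 1)) * sepVel e l (k + 1) (i + 1) + l (i + 1)) /
        ((1 + e (i + 1)) * (1 + e (k + 1))) := by
  have hi := H.e_succ_pos i
  have hk := H.e_succ_pos k
  have hsub := sub_ne_zero.2 h.symm
  have hLi : α * L i = e (i + 1) * l (i + 1) / (1 + e (i + 1)) - (2 - t) / 2 := by
    rw [H.l_succ]; field_simp; ring
  have hLk : α * L k = e (k + 1) * l (k + 1) / (1 + e (k + 1)) - (2 - t) / 2 := by
    rw [H.l_succ]; field_simp; ring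
  rw [mul_sub, hLi, hLk, sepVel]
  field_simp
  ring

lemma exists_mul_vel_le_mul_L_sub (H : LogVelocity α t e o l L) (hj : Even j)
    (hsep : 0 ≤ sepVel e l (j + 1) j) (hsep' : 0 ≤ sepVel e l (j + 1) j + l j) :
    ∃ k ∈ Icc (0 : ℝ) 1, k * vel e l j ≤ α * (L j - L (j + 1)) := by
  obtain ⟨hpx, hxq⟩ := H.lt_of_even hj
  have hp := H.e_nonneg j
  have hx : 0 < e (j + 2) := H.e_succ_pos (j + 1)
  have hq : e (j + 1) < 1 := by linarith [H.e_le (j + 1), H.lt_two]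
  have hskip := sepVel_succ_self_eq (l := l) hpx.ne hxq.ne' (hpx.trans hxq).ne
  have hL : α * (L j - L (j + 1)) = (e (j + 1) - e (j + 2)) *
      ((1 + e (j + 2)) * sepVel e l (j + 1) (j + 2) + l (j + 2)) /
        ((1 + e (j + 2)) * (1 + e (j + 1))) := H.mul_L_sub hxq.ne
  set r := (e (j + 1) - e (j + 2)) / (e (j + 1) - e j)
  have hr0 : 0 ≤ r := div_nonneg (by linarith) (by linarith)
  have hr1 : r ≤ 1 := div_le_one_of_le₀ (by linarith) (by linarith)
  have hrp : r * (1 + e j) ≤ 1 * (1 + e (j + 2)) := by gcongr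
  have hrp0 : 0 ≤ r * (1 + e j) := by positivity
  have hden : 0 < (1 + e (j + 2)) * (1 + e (j + 1)) := by nlinarith
  refine ⟨(e (j + 1) - e (j + 2)) * (1 + e (j + 2) - r * (1 + e j)) /
    ((1 + e (j + 2)) * (1 + e (j + 1))), ⟨?_, ?_⟩, ?_⟩
  · exact div_nonneg (mul_nonneg (by linarith) (by linarith)) hden.le
  · exact div_le_one_of_le₀ (by nlinarith) hden.le
  · rw [hL, one_add_mul_sepVel_succ_add hx.ne' hpx.ne, div_mul_eq_mul_div, mul_assoc]
    have hpsep : 0 ≤ e j * sepVel e l (j + 1) j := mul_nonneg hp hsep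
    gcongr
    linear_combination hsep' + hpsep + (1 + e j) * hskip

lemma l_le_l_succ (H : LogVelocity α t e o l L) (hj : Even j) (hvel : 0 ≤ vel e l j)
    (hsep : 0 ≤ sepVel e l (j + 1) j) : l (j + 2) ≤ l (j + 1) :=
  le_of_sepVel_nonneg (H.e_succ_pos j) (H.lt_of_even hj).2
    (le_sepVel_succ (H.e_nonneg j) (H.lt_of_even hj).1 (H.lt_of_even hj).2 hvel hvel hsep)

lemma sub_one_mul_zeta_mul_le (H : LogVelocity α t e o l L) (hl : l (j + 2) ≤ l (j + 1)) :
    (α - 1) * zeta α t (e (j + 1)) * (α * l (j + 2) + (2 - t) / 2) ≤ (2 - t) / 2 := by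
  have hα := H.one_lt_exp
  have hx : 0 < e (j + 2) := H.e_succ_pos (j + 1)
  have hτ : 0 < (2 - t) / 2 := by linarith [H.lt_two]
  have hz := H.zeta_pos j
  rcases le_or_gt (α * l (j + 2) + (2 - t) / 2) 0 with hθ | hθ
  · exact (mul_nonpos_of_nonneg_of_nonpos (mul_nonneg (by linarith) hz.le) hθ).trans hτ.le
  have hsucc : e (j + 2) * l (j + 2) = (1 + e (j + 2)) * ((2 - t) / 2 + α * L (j + 1)) :=
    H.l_succ (j + 1)
  have hmono : zeta α t (e (j + 1)) * (α * l (j + 2) + (2 - t) / 2) ≤ -L (j + 1) := by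
    rw [H.L_eq, neg_neg]
    gcongr
  have hsq : α ^ 2 * (zeta α t (e (j + 1)) * (α * l (j + 2) + (2 - t) / 2)) ≤
      (α + 1) * ((2 - t) / 2) := by
    refine le_of_mul_le_mul_left ?_ (by linarith : 0 < 1 + e (j + 2))
    linear_combination (1 + e (j + 2)) * α ^ 2 * hmono + e (j + 2) * hθ.le + α * hsucc + hτ.le
  refine le_of_mul_le_mul_left ?_ (by positivity : 0 < α ^ 2)
  linear_combination (α - 1) * hsq + hτ.le

lemma mul_le_mul_div_zeta (H : LogVelocity α t e o l L) (hl : l (j + 2) ≤ l (j + 1)) {c d : ℝ}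
    (hc : 0 ≤ c) (hd : 0 ≤ d) (hcd : c ≤ (α - 1) * d) :
    (α * l (j + 2) + (2 - t) / 2) * c ≤ (2 - t) / 2 * (d / zeta α t (e (j + 1))) := by
  have hz := H.zeta_pos j
  have hτ : 0 < (2 - t) / 2 := by linarith [H.lt_two]
  rcases le_or_gt (α * l (j + 2) + (2 - t) / 2) 0 with hθ | hθ
  · exact (mul_nonpos_of_nonpos_of_nonneg hθ hc).trans (by positivity)
  rw [← mul_div_assoc, le_div_iff₀ hz]
  calc (α * l (j + 2) + (2 - t) / 2) * c * zeta α t (e (j + 1))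
      ≤ (α * l (j + 2) + (2 - t) / 2) * ((α - 1) * d) * zeta α t (e (j + 1)) := by gcongr
    _ = (α - 1) * zeta α t (e (j + 1)) * (α * l (j + 2) + (2 - t) / 2) * d := by ring
    _ ≤ (2 - t) / 2 * d := by gcongr; exact H.sub_one_mul_zeta_mul_le hl

end LogVelocity

/-- The velocity lost up to the even index `j` in the induction on the bounds below. -/
noncomputable def loss (α t : ℝ) (e : ℕ → ℝ) (j : ℕ) : ℝ :=
  (2 - t) / 2 * (zeta α t (e j) / zeta α t (e (j + 1)))

namespace CriticalOrbit

variable {α t : ℝ} {e o : ℕ → ℝ} {j : ℕ}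

lemma loss_zero (H : CriticalOrbit α t e o) : loss α t e 0 = 0 := by
  rw [loss, H.zeta_zero, zero_div, mul_zero]

lemma loss_nonneg (H : CriticalOrbit α t e o) (j : ℕ) : 0 ≤ loss α t e j :=
  mul_nonneg (by linarith [H.lt_two]) (div_nonneg (H.zeta_nonneg j) (H.zeta_pos j).le)

lemma loss_le (H : CriticalOrbit α t e o) (hj : Even j) : loss α t e j ≤ (2 - t) / 2 :=
  mul_le_of_le_one_right (by linarith [H.lt_two])
    (div_le_one_of_le₀ (H.zeta_lt (H.lt_succ_of_even hj)).le (H.zeta_pos j).le)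

lemma loss_add_le (H : CriticalOrbit α t e o) (hj : Even j) :
    loss α t e j + (2 - t) / 2 *
      ((zeta α t (e (j + 2)) - zeta α t (e j)) / zeta α t (e (j + 1))) ≤ loss α t e (j + 2) := by
  have hτ : 0 ≤ (2 - t) / 2 := by linarith [H.lt_two]
  have hmono : zeta α t (e (j + 2)) / zeta α t (e (j + 1)) ≤
      zeta α t (e (j + 2)) / zeta α t (e (j + 3)) :=
    div_le_div_of_nonneg_left (H.zeta_nonneg _) (H.zeta_pos _)
      (H.zeta_lt (H.lt_add_three_of_even hj).2).le
  rw [loss, loss, ← mul_add, ← add_div, add_sub_cancel]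
  exact mul_le_mul_of_nonneg_left hmono hτ

lemma mul_sub_le_of_le_div (H : CriticalOrbit α t e o) (hj : Even j) {K : ℝ}
    (hK : K ≤ e j / (e (j + 2) - e j)) : K * (e (j + 2) - e j) ≤ e j :=
  (le_div_iff₀ (sub_pos.2 (H.lt_of_even hj).1)).1 hK

end CriticalOrbit

namespace LogVelocity

variable {α t : ℝ} {e o l L : ℕ → ℝ} {j : ℕ}

lemma le_vel_add_mul_sub (H : LogVelocity α t e o l L) (hj : Even j) (hvel : 0 ≤ vel e l j)
    {K m : ℝ} (hK : 0 ≤ K) (hK' : K ≤ e j / (e (j + 2) - e j)) (hm : m ≤ vel e l j)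
    (hm' : m ≤ sepVel e l (j + 1) j) : m ≤ vel e l j + K * (l (j + 2) - l j) := by
  obtain ⟨hpx, hxq⟩ := H.lt_of_even hj
  exact PowerLaw.le_vel_add_mul_sub (H.e_succ_pos (j + 1)) hpx hxq hvel hK
    ((H.mul_sub_le_of_le_div hj hK').trans hpx.le) hm hm'

lemma le_vel_add_mul_sub_add (H : LogVelocity α t e o l L) (hj : Even j) (hvel : 0 ≤ vel e l j)
    {K m : ℝ} (hK : 0 ≤ K) (hK' : K ≤ e j / (e (j + 2) - e j)) (hm : m ≤ vel e l j + l j)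
    (hm' : m ≤ sepVel e l (j + 1) j + l j) :
    m ≤ vel e l j + K * (l (j + 2) - l j) + l (j + 2) := by
  obtain ⟨hpx, hxq⟩ := H.lt_of_even hj
  linarith [PowerLaw.le_vel_add_mul_sub (K := K + 1) (m := m - l j) (H.e_succ_pos (j + 1)) hpx hxq
    hvel (by linarith) (by linarith [H.mul_sub_le_of_le_div hj hK']) (by linarith) (by linarith)]

lemma le_vel_o (H : LogVelocity α t e o l L) (hj : Even j) (hvel : 0 ≤ vel e l j)
    (hsep : 0 ≤ sepVel e l (j + 1) j) {m : ℝ} (hm : m ≤ vel e l j)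
    (hm' : m ≤ sepVel e l (j + 1) j) : m ≤ vel o L j := by
  obtain ⟨hpx, hxq⟩ := H.lt_of_even hj
  rw [H.vel_o_eq]
  linarith [H.le_vel_add_mul_sub hj hvel (H.logDefect_e_nonneg hpx.ne) (H.logDefect_e_le_div hpx)
    hm hm', mul_nonneg (H.logDefect_e_nonneg hxq.ne') (sub_nonneg.2 (H.l_le_l_succ hj hvel hsep))]

lemma sub_le_vel_e_succ (H : LogVelocity α t e o l L) (hj : Even j) (hvel : 0 ≤ vel e l j)
    (hsep : 0 ≤ sepVel e l (j + 1) j) {m : ℝ} (hm : m ≤ vel e l j)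
    (hm' : m ≤ sepVel e l (j + 1) j) : m - (2 - t) / 2 ≤ vel e l (j + 1) := by
  obtain ⟨hpx, hxq⟩ := H.lt_of_even hj
  have hl := H.l_le_l_succ hj hvel hsep
  have hmain := H.le_vel_add_mul_sub hj hvel (H.iterDefect_nonneg hpx.ne)
    (H.iterDefect_le_div hpx) hm hm'
  have hrest := mul_nonneg (H.iterDefect_nonneg hxq.ne') (sub_nonneg.2 hl)
  have hzpx := sub_nonneg.2 (H.zeta_lt hpx).le
  have hzxq := sub_nonneg.2 (H.zeta_lt hxq).le
  set c := logDefect α (o (j + 1)) (o (j + 2)) * (zeta α t (e (j + 1)) - zeta α t (e (j + 2))) +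
    logDefect α (o j) (o (j + 2)) * (zeta α t (e (j + 2)) - zeta α t (e j)) with hc
  have hc0 : 0 ≤ c := add_nonneg (mul_nonneg (H.logDefect_o_nonneg hxq.ne') hzxq)
    (mul_nonneg (H.logDefect_o_nonneg hpx.ne) hzpx)
  have hc1 : c ≤ (α - 1) * zeta α t (e (j + 1)) := by
    linarith [mul_le_mul_of_nonneg_right (H.logDefect_o_le hxq.ne') hzxq,
      mul_le_mul_of_nonneg_right (H.logDefect_o_le hpx.ne) hzpx,
      mul_nonneg (sub_nonneg.2 H.one_lt_exp.le) (H.zeta_nonneg j)]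
  have hloss := H.mul_le_mul_div_zeta hl hc0 (H.zeta_nonneg (j + 1)) hc1
  rw [div_self (H.zeta_pos j).ne', mul_one] at hloss
  rw [iterDefect] at hmain hrest
  rw [H.vel_e_succ_eq, H.vel_o_eq, H.L_sub_eq j (j + 2), ← neg_sub (L (j + 2)) (L (j + 1)),
    H.L_sub_eq (j + 1) (j + 2)]
  linarith

lemma le_sepVel_add_two (H : LogVelocity α t e o l L) (hj : Even j)
    (hvel : 0 ≤ vel e l (j + 1)) {m : ℝ} (hm : m ≤ sepVel e l (j + 1) (j + 2)) :
    m ≤ sepVel e l (j + 3) (j + 2) := by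
  obtain ⟨hxy, hyq⟩ := H.lt_add_three_of_even hj
  have hsep : sepVel e l (j + 3) (j + 2) = sepVel e l (j + 1) (j + 2) +
      (e (j + 1) - e (j + 3)) / (e (j + 1) - e (j + 2)) * vel e l (j + 1) :=
    sepVel_add_two_succ_eq hyq.ne' hxy.ne (hxy.trans hyq).ne'
  have hterm := mul_nonneg (div_nonneg (sub_nonneg.2 hyq.le) (sub_nonneg.2 (hxy.trans hyq).le)) hvel
  linarith

lemma vel_e_add_two_eq (H : LogVelocity α t e o l L) (j : ℕ) :
    vel e l (j + 2) = vel e l j + iterDefect α t e o j (j + 2) * (l (j + 2) - l j) -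
      (α * l (j + 2) + (2 - t) / 2) *
        (logDefect α (o j) (o (j + 2)) * (zeta α t (e (j + 2)) - zeta α t (e j))) +
      (logDefect α (e (j + 1)) (e (j + 2)) - logDefect α (e (j + 1)) (e (j + 3))) *
        (l (j + 1) - l (j + 2)) +
      (logDefect α (e (j + 1)) (e (j + 3)) - logDefect α (e (j + 2)) (e (j + 3))) *
        (l (j + 3) - l (j + 2)) +
      (logDefect α (o (j + 1)) (o (j + 3)) - logDefect α (o (j + 1)) (o (j + 2))) *
        (L (j + 2) - L (j + 1)) +
      (logDefect α (o (j + 2)) (o (j + 3)) - logDefect α (o (j + 1)) (o (j + 3))) *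
        (L (j + 2) - L (j + 3)) := by
  rw [H.vel_e_succ_eq (j + 1), H.vel_o_eq (j + 1), H.vel_e_succ_eq j, H.vel_o_eq j,
    H.L_sub_eq j (j + 2), iterDefect]
  ring

lemma L_succ_le (H : LogVelocity α t e o l L) (hj : Even j)
    (hsep : 0 ≤ sepVel e l (j + 3) (j + 2)) (hsep' : 0 ≤ sepVel e l (j + 3) (j + 2) + l (j + 2)) :
    L (j + 1) ≤ L (j + 2) := by
  have hxy := (H.lt_add_three_of_even hj).1
  have hx : 0 < e (j + 2) := H.e_succ_pos (j + 1)
  have hL : α * (L (j + 2) - L (j + 1)) = (e (j + 3) - e (j + 2)) *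
      ((1 + e (j + 2)) * sepVel e l (j + 3) (j + 2) + l (j + 2)) /
        ((1 + e (j + 2)) * (1 + e (j + 3))) := H.mul_L_sub hxy.ne
  have hnonneg : 0 ≤ α * (L (j + 2) - L (j + 1)) := by
    rw [hL]
    exact div_nonneg (mul_nonneg (by linarith) (by linarith [mul_nonneg hx.le hsep]))
      (mul_nonneg (by linarith) (by linarith))
  linarith [nonneg_of_mul_nonneg_right hnonneg H.exp_pos]

end LogVelocity

lemma le_of_add_mul_le {α c k m a d : ℝ} (hα : 0 < α) (hc : 0 ≤ c) (hcα : c ≤ α)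
    (hk : k ∈ Icc (0 : ℝ) 1) (hm : 0 < m) (hd : k * a ≤ α * d) (h : m + c * d ≤ a) : m ≤ a := by
  have ha : 0 ≤ a := by
    by_contra! ha
    have hda : a ≤ α * d := by nlinarith [mul_nonneg_of_nonpos_of_nonpos ha.le (sub_nonpos.2 hk.2)]
    have hcda : α * a ≤ α * (c * d) := by
      linarith [mul_le_mul_of_nonneg_left hda hc, mul_le_mul_of_nonpos_right hcα ha.le]
    linarith [le_of_mul_le_mul_left hcda hα]
  have hd0 : 0 ≤ d := nonneg_of_mul_nonneg_right ((mul_nonneg hk.1 ha).trans hd) hα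
  linarith [mul_nonneg hc hd0]

namespace LogVelocity

variable {α t : ℝ} {e o l L : ℕ → ℝ} {j : ℕ}

lemma le_vel_e_add_two (H : LogVelocity α t e o l L) (hj : Even j) {m : ℝ} (hm : 0 < m)
    (hl : l (j + 2) ≤ l (j + 1)) (hsep : 0 ≤ sepVel e l (j + 3) (j + 2))
    (hsep' : 0 ≤ sepVel e l (j + 3) (j + 2) + l (j + 2))
    (hle : m ≤ vel e l j + iterDefect α t e o j (j + 2) * (l (j + 2) - l j) -
      (α * l (j + 2) + (2 - t) / 2) *
        (logDefect α (o j) (o (j + 2)) * (zeta α t (e (j + 2)) - zeta α t (e j)))) :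
    m ≤ vel e l (j + 2) := by
  have hα := H.one_lt_exp.le
  obtain ⟨hxy, hyq⟩ := H.lt_add_three_of_even hj
  have hx := H.e_nonneg (j + 2)
  have hox := H.o_pos (j + 1)
  have hl' : l (j + 2) ≤ l (j + 3) := le_of_sepVel_nonneg (H.e_succ_pos (j + 2)) hxy hsep
  obtain ⟨k, hk, hkvel⟩ := H.exists_mul_vel_le_mul_L_sub (hj.add even_two) hsep hsep'
  have hc : 0 ≤ logDefect α (o (j + 2)) (o (j + 3)) - logDefect α (o (j + 1)) (o (j + 3)) :=
    sub_nonneg.2 (logDefect_le_of_lt_of_lt hα hox.le (H.o_lt hyq) (H.o_lt hxy))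
  have hcα : logDefect α (o (j + 2)) (o (j + 3)) - logDefect α (o (j + 1)) (o (j + 3)) ≤ α := by
    linarith [H.logDefect_o_le hxy.ne, H.logDefect_o_nonneg hyq.ne']
  refine le_of_add_mul_le H.exp_pos hc hcα hk hm hkvel ?_
  have hterm_l := mul_nonneg (sub_nonneg.2 (logDefect_anti_right hα hx hxy.le hyq))
    (sub_nonneg.2 hl)
  have hterm_l' := mul_nonneg (sub_nonneg.2 (logDefect_le_of_lt_of_lt hα hx hxy hyq))
    (sub_nonneg.2 hl')
  have hterm_L := mul_nonneg (sub_nonneg.2 (logDefect_anti_right_above hα hox (H.o_lt hyq)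
    (H.o_lt hxy).le)) (sub_nonneg.2 (H.L_succ_le hj hsep hsep'))
  rw [H.vel_e_add_two_eq]
  linarith

lemma l_one (H : LogVelocity α t e o l L) : (t - 1) * l 1 = t * ((2 - t) / 2) := by
  have hsucc : e 1 * l 1 = (1 + e 1) * ((2 - t) / 2 + α * L 0) := H.l_succ 0
  rw [H.L_eq, H.zeta_zero, H.e_one] at hsucc
  linarith

lemma lt_l_one (H : LogVelocity α t e o l L) : (2 - t) / 2 < l 1 := by
  refine lt_of_mul_lt_mul_left ?_ (sub_nonneg.2 H.one_lt.le)
  linarith [H.l_one, H.lt_two]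

/-- The bounds propagated along the even indices `j`; the multiples of `vel e l 0` and `l 1` they
start from are eroded by `loss`. -/
structure Bounds (α t : ℝ) (e l : ℕ → ℝ) (j : ℕ) : Prop where
  le_vel : vel e l 0 - loss α t e j ≤ vel e l j
  le_sepVel : vel e l 0 - loss α t e j ≤ sepVel e l (j + 1) j
  le_vel_add : l 1 - loss α t e j ≤ vel e l j + l j
  le_sepVel_add : l 1 ≤ sepVel e l (j + 1) j + l j

lemma bounds_zero (H : LogVelocity α t e o l L) : Bounds α t e l 0 := by
  have hsep : sepVel e l 1 0 = vel e l 0 := by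
    rw [sepVel, H.l_zero, H.e_zero, sub_zero, sub_sub_cancel,
      mul_div_cancel_left₀ _ (H.e_succ_pos 0).ne']
  have hl := H.l_zero
  refine ⟨?_, ?_, ?_, ?_⟩ <;> simp only [H.loss_zero, zero_add, hsep] <;> linarith

namespace Bounds

lemma sub_le_vel (hb : Bounds α t e l j) (H : LogVelocity α t e o l L) (hj : Even j) :
    vel e l 0 - (2 - t) / 2 ≤ vel e l j := by
  linarith [hb.le_vel, H.loss_le hj]

lemma sub_le_sepVel (hb : Bounds α t e l j) (H : LogVelocity α t e o l L) (hj : Even j) :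
    vel e l 0 - (2 - t) / 2 ≤ sepVel e l (j + 1) j := by
  linarith [hb.le_sepVel, H.loss_le hj]

lemma vel_pos (hb : Bounds α t e l j) (H : LogVelocity α t e o l L) (hj : Even j)
    (h0 : 2 - t < vel e l 0) : 0 < vel e l j := by
  linarith [hb.sub_le_vel H hj, H.lt_two]

lemma sepVel_pos (hb : Bounds α t e l j) (H : LogVelocity α t e o l L) (hj : Even j)
    (h0 : 2 - t < vel e l 0) : 0 < sepVel e l (j + 1) j := by
  linarith [hb.sub_le_sepVel H hj, H.lt_two]

lemma vel_add_pos (hb : Bounds α t e l j) (H : LogVelocity α t e o l L) (hj : Even j) :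
    0 < vel e l j + l j := by
  linarith [hb.le_vel_add, H.loss_le hj, H.lt_l_one]

lemma sepVel_add_pos (hb : Bounds α t e l j) (H : LogVelocity α t e o l L) :
    0 < sepVel e l (j + 1) j + l j := by
  linarith [hb.le_sepVel_add, H.lt_l_one, H.lt_two]

lemma le_vel_o (hb : Bounds α t e l j) (H : LogVelocity α t e o l L) (hj : Even j)
    (h0 : 2 - t < vel e l 0) : vel e l 0 - (2 - t) / 2 ≤ vel o L j :=
  H.le_vel_o hj (hb.vel_pos H hj h0).le (hb.sepVel_pos H hj h0).le (hb.sub_le_vel H hj)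
    (hb.sub_le_sepVel H hj)

lemma le_vel_e_succ (hb : Bounds α t e l j) (H : LogVelocity α t e o l L) (hj : Even j)
    (h0 : 2 - t < vel e l 0) : vel e l 0 - (2 - t) ≤ vel e l (j + 1) := by
  linarith [H.sub_le_vel_e_succ hj (hb.vel_pos H hj h0).le (hb.sepVel_pos H hj h0).le
    (hb.sub_le_vel H hj) (hb.sub_le_sepVel H hj)]

end Bounds

lemma Bounds.add_two (hb : Bounds α t e l j) (H : LogVelocity α t e o l L) (hj : Even j)
    (h0 : 2 - t < vel e l 0) : Bounds α t e l (j + 2) := by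
  obtain ⟨hpx, hxq⟩ := H.lt_of_even hj
  have hvel := (hb.vel_pos H hj h0).le
  have hvel' : 0 ≤ vel e l (j + 1) := by linarith [hb.le_vel_e_succ H hj h0]
  have hl := H.l_le_l_succ hj hvel (hb.sepVel_pos H hj h0).le
  have hlossj := H.loss_nonneg j
  have hloss := H.loss_add_le hj
  have hlossτ := H.loss_le (hj.add even_two)
  have hΔ := sub_nonneg.2 (H.zeta_lt hpx).le
  have hsep : vel e l 0 - loss α t e j ≤ sepVel e l (j + 3) (j + 2) :=
    H.le_sepVel_add_two hj hvel'
      (le_sepVel_succ (H.e_nonneg j) hpx hxq hvel hb.le_vel hb.le_sepVel)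
  have hsep' : l 1 ≤ sepVel e l (j + 3) (j + 2) + l (j + 2) := by
    linarith [H.le_sepVel_add_two hj hvel' le_rfl, hb.le_sepVel_add,
      sepVel_add_le_sepVel_succ_add (H.e_succ_pos (j + 1)) hpx hxq hvel]
  have hdrift := H.le_vel_add_mul_sub hj hvel (H.iterDefect_nonneg hpx.ne)
    (H.iterDefect_le_div hpx) hb.le_vel hb.le_sepVel
  have hdrift' := H.le_vel_add_mul_sub_add hj hvel (H.iterDefect_nonneg hpx.ne)
    (H.iterDefect_le_div hpx) hb.le_vel_add (by linarith [hb.le_sepVel_add])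
  have hstep : vel e l j + iterDefect α t e o j (j + 2) * (l (j + 2) - l j) -
      (loss α t e (j + 2) - loss α t e j) ≤ vel e l (j + 2) := by
    refine H.le_vel_e_add_two hj (by linarith [H.lt_two]) hl (by linarith [H.loss_le hj, H.lt_two])
      (by linarith [H.lt_l_one, H.lt_two]) ?_
    linarith [H.mul_le_mul_div_zeta hl (mul_nonneg (H.logDefect_o_nonneg hpx.ne) hΔ) hΔ
      (mul_le_mul_of_nonneg_right (H.logDefect_o_le hpx.ne) hΔ)]
  have hmono : loss α t e j ≤ loss α t e (j + 2) := by
    linarith [mul_nonneg (by linarith [H.lt_two] : 0 ≤ (2 - t) / 2)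
      (div_nonneg hΔ (H.zeta_pos j).le)]
  exact ⟨by linarith, by linarith, by linarith, hsep'⟩

lemma bounds_of_even (H : LogVelocity α t e o l L) (h0 : 2 - t < vel e l 0) (hj : Even j) :
    Bounds α t e l j := by
  obtain ⟨m, rfl⟩ := hj
  induction m with
  | zero => exact H.bounds_zero
  | succ m ih =>
    rw [show m + 1 + (m + 1) = m + m + 2 by ring]
    exact ih.add_two H ⟨m, rfl⟩ h0

end LogVelocity

lemma log_le_sub_inv_div_two {R : ℝ} (hR : 1 ≤ R) : log R ≤ (R - R⁻¹) / 2 := by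
  have h := self_le_sinh_iff.2 (log_nonneg hR)
  rwa [sinh_log (by linarith)] at h

lemma log_mul_rpow_div_mul_rpow {α c u v : ℝ} (hc : c ≠ 0) (hu : 0 < u) (hv : 0 < v) :
    log (c * v ^ α / (c * u ^ α)) = α * log (v / u) := by
  rw [mul_div_mul_left _ _ hc, ← div_rpow hv.le hu.le, log_rpow (div_pos hv hu)]

lemma two_mul_mul_div_sq_sub_sq_le {α c u v : ℝ} (hα : 0 < α) (hc : 0 < c) (hu : 0 < u)
    (huv : u < v) :
    2 * (c * u ^ α) * (c * v ^ α) / ((c * v ^ α) ^ 2 - (c * u ^ α) ^ 2) ≤ v / (α * (v - u)) := by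
  have hv : 0 < v := hu.trans huv
  have hUV : c * u ^ α < c * v ^ α := by gcongr
  have hlog := log_mul_rpow_div_mul_rpow (α := α) hc.ne' hu hv
  have hU : 0 < c * u ^ α := by positivity
  set U := c * u ^ α
  set V := c * v ^ α
  have hV : 0 < V := hU.trans hUV
  have hsq : 0 < V ^ 2 - U ^ 2 := sub_pos.2 (pow_lt_pow_left₀ hUV hU.le two_ne_zero)
  have hlower : α * (1 - (v / u)⁻¹) ≤ α * log (v / u) := by
    gcongr
    exact one_sub_inv_le_log_of_pos (div_pos hv hu)
  have hupper := log_le_sub_inv_div_two ((one_le_div hU).2 hUV.le)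
  have hdiv : α * (v - u) / v ≤ (V ^ 2 - U ^ 2) / (2 * U * V) := calc
    α * (v - u) / v = α * (1 - (v / u)⁻¹) := by field_simp
    _ ≤ (V / U - (V / U)⁻¹) / 2 := hlower.trans (hlog.ge.trans hupper)
    _ = (V ^ 2 - U ^ 2) / (2 * U * V) := by field_simp
  rw [div_le_div_iff₀ hv (by positivity)] at hdiv
  rw [div_le_div_iff₀ hsq (mul_pos hα (sub_pos.2 huv))]
  linarith

lemma div_mul_sub_le_add_div {α c u v : ℝ} (hα : 0 < α) (hc : 0 < c) (hu : 0 < u) (huv : u < v) :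
    u / (α * (v - u)) ≤ (c * v ^ α + c * u ^ α) / (2 * (c * v ^ α - c * u ^ α)) := by
  have hv : 0 < v := hu.trans huv
  have hUV : c * u ^ α < c * v ^ α := by gcongr
  have hlog := log_mul_rpow_div_mul_rpow (α := α) hc.ne' hu hv
  have hU : 0 < c * u ^ α := by positivity
  set U := c * u ^ α
  set V := c * v ^ α
  have hV : 0 < V := hU.trans hUV
  have hlower := le_log_one_add_of_nonneg (sub_nonneg.2 ((one_le_div hU).2 hUV.le))
  rw [add_sub_cancel, hlog] at hlower
  have hupper : α * log (v / u) ≤ α * (v / u - 1) := by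
    gcongr
    exact log_le_sub_one_of_pos (div_pos hv hu)
  have hdiv : 2 * (V - U) / (V + U) ≤ α * (v - u) / u := calc
    2 * (V - U) / (V + U) = 2 * (V / U - 1) / (V / U - 1 + 2) := by
        rw [show V / U - 1 + 2 = (V + U) / U by field_simp; ring]
        field_simp
    _ ≤ α * (v / u - 1) := hlower.trans hupper
    _ = α * (v - u) / u := by field_simp
  rw [div_le_div_iff₀ (by positivity) hu] at hdiv
  rw [div_le_div_iff₀ (mul_pos hα (sub_pos.2 huv)) (by linarith)]
  linarith

lemma div_sub_le_div_mul_sub {α c u v : ℝ} (hα : 1 ≤ α) (hc : 0 < c) (hu : 0 < u) (huv : u < v) :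
    c * u ^ α / (c * v ^ α - c * u ^ α) ≤ u / (α * (v - u)) := by
  have hα0 : 0 < α := by linarith
  have hpow : u ^ α < v ^ α := by gcongr
  rw [← mul_sub, mul_div_mul_left _ _ hc.ne', div_le_div_iff₀ (sub_pos.2 hpow)
    (mul_pos hα0 (sub_pos.2 huv))]
  linarith [mul_rpow_sub_le hα hu.le (hu.trans huv).le]

section

variable {P Q X D a t τ : ℝ}

lemma div_le_of_nonpos (hX : 1 ≤ X) (hXQ : X ≤ Q) (hQ : Q ≤ t) (ha : 0 ≤ a) (hD : D ≤ 0) :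
    a / t ≤ 2 * (X * a + D) / (Q + X) - D / X := by
  have hX0 : 0 < X := by linarith
  have hD' : D / X ≤ 2 * D / (Q + X) := by
    rw [div_le_div_iff₀ hX0 (by linarith)]
    nlinarith
  calc a / t ≤ 2 * (X * a) / (Q + X) := by
        rw [div_le_div_iff₀ (by linarith) (by linarith)]
        nlinarith [mul_nonneg ha (by nlinarith : 0 ≤ 2 * X * t - (Q + X))]
    _ ≤ 2 * (X * a + D) / (Q + X) - D / X := by
        rw [mul_add, add_div]
        linarith

lemma div_sub_le_of_nonneg (hP : 1 ≤ P) (hPX : P ≤ X) (hXQ : X ≤ Q) (hQ : Q ≤ t) (ha : 0 ≤ a)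
    (hτ : 0 ≤ τ) (hD : 0 ≤ D) (hDle : (Q - P) * D ≤ P * Q * τ + (P * (P + X) - P - Q) * a) :
    a / t - τ ≤ 2 * (X * a + D) / (Q + X) - (X + P) * D / (2 * P * X) := by
  have hP0 : 0 < P := by linarith
  have hX0 : 0 < X := by linarith
  have hQX : 0 < Q + X := by linarith
  have hfactor : (X + P) * (Q + X) - 4 * P * X ≤ 2 * X * (Q - P) := by
    linarith [mul_nonneg (sub_nonneg.2 hXQ) (sub_nonneg.2 hPX)]
  calc a / t - τ ≤ a / P - τ :=
        sub_le_sub_right (div_le_div_of_nonneg_left ha hP0 (by linarith)) τ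
    _ ≤ (2 * X * a - (P * Q * τ + (P * (P + X) - P - Q) * a) / P) / (Q + X) := by
        rw [le_div_iff₀ hQX, ← sub_nonneg]
        have hdiff : 2 * X * a - (P * Q * τ + (P * (P + X) - P - Q) * a) / P -
            (a / P - τ) * (Q + X) = (P - 1) * (X - P) * a / P + X * τ := by
          field_simp
          ring
        rw [hdiff]
        exact add_nonneg (div_nonneg (mul_nonneg (mul_nonneg (sub_nonneg.2 hP) (sub_nonneg.2 hPX))
          ha) hP0.le) (mul_nonneg hX0.le hτ)
    _ ≤ (2 * X * a - (Q - P) * D / P) / (Q + X) := by gcongr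
    _ = (2 * X * a - 2 * X * (Q - P) * D / (2 * P * X)) / (Q + X) := by field_simp
    _ ≤ (2 * X * a - ((X + P) * (Q + X) - 4 * P * X) * D / (2 * P * X)) / (Q + X) := by gcongr
    _ = 2 * (X * a + D) / (Q + X) - (X + P) * D / (2 * P * X) := by
        field_simp
        ring

end

namespace LogVelocity

variable {α t : ℝ} {e o l L : ℕ → ℝ} {j : ℕ}

lemma sub_mul_skip_eq (H : LogVelocity α t e o l L) (hj : Even j) :
    (e (j + 1) - e j) * ((1 + e j) * sepVel e l (j + 2) j + l j) =
      (1 + e j) * (1 + e (j + 1)) * ((2 - t) / 2 -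
        α * zeta α t (e j) * (α * l j + (2 - t) / 2)) - (1 + e (j + 1)) * (e j * l j) -
      (1 + e j) * (e (j + 1) - e (j + 2)) * vel e l j := by
  obtain ⟨hpx, hxq⟩ := H.lt_of_even hj
  have hqp : e (j + 1) - e j ≠ 0 := by linarith
  have hsucc : e (j + 1) * l (j + 1) = (1 + e (j + 1)) * ((2 - t) / 2 -
      α * zeta α t (e j) * (α * l j + (2 - t) / 2)) := by
    rw [H.l_succ, H.L_eq]
    ring
  have hsep : (e (j + 1) - e j) * sepVel e l (j + 1) j = e (j + 1) * (l (j + 1) - l j) := by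
    rw [sepVel]
    field_simp
  have hskip : (e (j + 1) - e j) * sepVel e l (j + 1) j =
      (e (j + 1) - e j) * sepVel e l (j + 2) j + (e (j + 1) - e (j + 2)) * vel e l j := by
    rw [sepVel_succ_self_eq hpx.ne hxq.ne' (hpx.trans hxq).ne]
    field_simp
  linear_combination (1 + e j) * (hsep - hskip + hsucc)

lemma sub_mul_skip_le (H : LogVelocity α t e o l L) (hj : Even j) (hvel : 0 ≤ vel e l j)
    (hadd : 0 ≤ vel e l j + l j) :
    (e (j + 1) - e j) * ((1 + e j) * sepVel e l (j + 2) j + l j) ≤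
      (1 + e j) * (1 + e (j + 1)) * ((2 - t) / 2) +
        ((1 + e j) * ((1 + e j) + (1 + e (j + 2))) - (1 + e j) - (1 + e (j + 1))) * vel e l j := by
  obtain ⟨hpx, hxq⟩ := H.lt_of_even hj
  have hτ : 0 ≤ (2 - t) / 2 := by linarith [H.lt_two]
  have hα := H.exp_pos.le
  have hp := H.e_nonneg j
  have hq := H.e_nonneg (j + 1)
  have hz := H.zeta_nonneg j
  have hzeta : α ^ 2 * zeta α t (e j) * (1 + e (j + 1)) ≤ e j := by
    refine le_of_mul_le_mul_right ?_ (sub_pos.2 (hpx.trans hxq))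
    exact (H.zeta_mul_le j (j + 1)).trans (by gcongr)
  have hdrift : -(α * zeta α t (e j) * (α * l j + (2 - t) / 2)) ≤
      α ^ 2 * zeta α t (e j) * vel e l j := by
    linarith [mul_nonneg (mul_nonneg (sq_nonneg α) hz) hadd, mul_nonneg (mul_nonneg hα hz) hτ]
  rw [H.sub_mul_skip_eq hj]
  linear_combination (1 + e j) * (1 + e (j + 1)) * hdrift + (1 + e j) * vel e l j * hzeta +
    (1 + e (j + 1)) * e j * hadd

end LogVelocity

lemma CriticalOrbit.one_add_e_succ {α t : ℝ} {e o : ℕ → ℝ} (H : CriticalOrbit α t e o) (j : ℕ) :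
    1 + e (j + 1) = t * o j ^ α := by
  rw [H.e_succ, add_sub_cancel]

namespace LogVelocity

variable {α t : ℝ} {e o l L : ℕ → ℝ} {j : ℕ}

lemma vel_o_succ_eq (H : LogVelocity α t e o l L) (j : ℕ) :
    vel o L (j + 1) = o (j + 2) / (α * (o (j + 2) - o (j + 3))) * (α * (L (j + 2) - L (j + 3))) -
      o (j + 1) / (α * (o (j + 3) - o (j + 1))) * (α * (L (j + 3) - L (j + 1))) := by
  have hα := H.exp_pos.ne'
  have h12 : o (j + 1 + 1) - o (j + 1 + 2) ≠ 0 := sub_ne_zero.2 (H.o_ne (H.e_ne_succ (j + 1)))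
  have h02 : o (j + 1) - o (j + 1 + 2) ≠ 0 := sub_ne_zero.2 (H.o_ne (H.e_ne_add_two (j + 1)))
  rw [vel, sepVel, sepVel, ← neg_sub (o (j + 1)) (o (j + 3))]
  field_simp
  ring

lemma vel_o_succ_lower (H : LogVelocity α t e o l L) (hj : Even j) {D : ℝ}
    (hD : (1 + e (j + 2)) * sepVel e l (j + 4) (j + 2) + l (j + 2) = D)
    (hL : 0 ≤ α * (L (j + 2) - L (j + 3))) :
    2 * ((1 + e (j + 4)) * vel e l (j + 2) + D) / ((1 + e (j + 3)) + (1 + e (j + 4))) -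
      o (j + 1) / (α * (o (j + 3) - o (j + 1))) *
        ((e (j + 4) - e (j + 2)) * D / ((1 + e (j + 2)) * (1 + e (j + 4)))) ≤
      vel o L (j + 1) := by
  obtain ⟨hpx, hxq⟩ : e (j + 2) < e (j + 4) ∧ e (j + 4) < e (j + 3) :=
    H.lt_of_even (hj.add even_two)
  have hlt := (H.lt_add_three_of_even hj).1
  have hp := H.e_succ_pos (j + 1)
  have hcoeff : 2 * (1 + e (j + 4)) * (1 + e (j + 3)) /
      ((1 + e (j + 3)) ^ 2 - (1 + e (j + 4)) ^ 2) ≤ o (j + 2) / (α * (o (j + 2) - o (j + 3))) := by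
    rw [H.one_add_e_succ (j + 3), H.one_add_e_succ (j + 2)]
    exact two_mul_mul_div_sq_sub_sq_le H.exp_pos H.param_pos (H.o_pos _) (H.o_lt hlt)
  have hskip := one_add_mul_sepVel_succ_add (l := l) (H.e_succ_pos (j + 3)).ne' hpx.ne
  have hA : α * (L (j + 2) - L (j + 3)) = (e (j + 3) - e (j + 4)) *
      ((1 + e (j + 4)) * sepVel e l (j + 3) (j + 4) + l (j + 4)) /
        ((1 + e (j + 4)) * (1 + e (j + 3))) := H.mul_L_sub hxq.ne
  have hC : α * (L (j + 3) - L (j + 1)) = (e (j + 4) - e (j + 2)) *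
      ((1 + e (j + 2)) * sepVel e l (j + 4) (j + 2) + l (j + 2)) /
        ((1 + e (j + 2)) * (1 + e (j + 4))) := H.mul_L_sub hpx.ne
  rw [hskip, add_assoc, hD] at hA
  have hmain := mul_le_mul_of_nonneg_right hcoeff hL
  rw [H.vel_o_succ_eq, hC, hD]
  refine sub_le_sub_right (le_of_eq_of_le ?_ hmain) _
  have hX : 1 + e (j + 4) ≠ 0 := by linarith
  have hQ : 1 + e (j + 3) ≠ 0 := by linarith
  have hQX : (1 + e (j + 3)) + (1 + e (j + 4)) ≠ 0 := by linarith
  have hsub : e (j + 3) - e (j + 4) ≠ 0 := by linarith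
  have hsq : (1 + e (j + 3)) ^ 2 - (1 + e (j + 4)) ^ 2 =
      (e (j + 3) - e (j + 4)) * ((1 + e (j + 3)) + (1 + e (j + 4))) := by ring
  rw [hA, hsq]
  field_simp

lemma div_sub_le_vel_o_succ (H : LogVelocity α t e o l L) (hj : Even j)
    (h0 : 2 - t < vel e l 0) : vel e l (j + 2) / t - (2 - t) / 2 ≤ vel o L (j + 1) := by
  have hj2 : Even (j + 2) := hj.add even_two
  have hb := H.bounds_of_even h0 hj2
  have hvel := (hb.vel_pos H hj2 h0).le
  have hτ : 0 ≤ (2 - t) / 2 := by linarith [H.lt_two]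
  obtain ⟨hpx, hxq⟩ : e (j + 2) < e (j + 4) ∧ e (j + 4) < e (j + 3) := H.lt_of_even hj2
  have hp := H.e_succ_pos (j + 1)
  have hQ : 1 + e (j + 3) ≤ t := by linarith [H.e_le (j + 3)]
  obtain ⟨k, hk, hkL⟩ := H.exists_mul_vel_le_mul_L_sub hj2 (hb.sepVel_pos H hj2 h0).le
    (hb.sepVel_add_pos H).le
  have hL : 0 ≤ α * (L (j + 2) - L (j + 3)) := (mul_nonneg hk.1 hvel).trans hkL
  have hoo : o (j + 1) < o (j + 3) := H.o_lt (H.lt_add_three_of_even hj).2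
  set D := (1 + e (j + 2)) * sepVel e l (j + 4) (j + 2) + l (j + 2) with hD
  refine le_trans ?_ (H.vel_o_succ_lower hj hD.symm hL)
  have hp0 : 1 + e (j + 2) ≠ 0 := by linarith
  have hx0 : 1 + e (j + 4) ≠ 0 := by linarith
  have hxp : e (j + 4) - e (j + 2) ≠ 0 := by linarith
  have hden : 0 ≤ (1 + e (j + 2)) * (1 + e (j + 4)) := mul_nonneg (by linarith) (by linarith)
  rcases le_total D 0 with hD0 | hD0
  · have hcoeff : (1 + e (j + 2)) / (e (j + 4) - e (j + 2)) ≤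
        o (j + 1) / (α * (o (j + 3) - o (j + 1))) := by
      have h := div_sub_le_div_mul_sub H.one_lt_exp.le H.param_pos (H.o_pos _) hoo
      rwa [← H.one_add_e_succ (j + 1), ← H.one_add_e_succ (j + 3), add_sub_add_left_eq_sub] at h
    have hterm := mul_le_mul_of_nonpos_right hcoeff (div_nonpos_of_nonpos_of_nonneg
      (mul_nonpos_of_nonneg_of_nonpos (sub_nonneg.2 hpx.le) hD0) hden)
    refine (sub_le_self _ hτ).trans ((div_le_of_nonpos (by linarith) (by linarith) hQ hvel
      hD0).trans (sub_le_sub_left (hterm.trans_eq ?_) _))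
    field_simp
  · have hcoeff : o (j + 1) / (α * (o (j + 3) - o (j + 1))) ≤
        ((1 + e (j + 4)) + (1 + e (j + 2))) / (2 * (e (j + 4) - e (j + 2))) := by
      have h := div_mul_sub_le_add_div H.exp_pos H.param_pos (H.o_pos _) hoo
      rwa [← H.one_add_e_succ (j + 1), ← H.one_add_e_succ (j + 3), add_sub_add_left_eq_sub] at h
    have hterm := mul_le_mul_of_nonneg_right hcoeff (div_nonneg
      (mul_nonneg (sub_nonneg.2 hpx.le) hD0) hden)
    have hDle := H.sub_mul_skip_le hj2 hvel (hb.vel_add_pos H hj2).le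
    refine (div_sub_le_of_nonneg (P := 1 + e (j + 2)) (by linarith) (by linarith) (by linarith) hQ
      hvel hτ hD0 ?_).trans (sub_le_sub_left (hterm.trans_eq ?_) _)
    · rwa [add_sub_add_left_eq_sub]
    · field_simp

theorem one_lt_vel (H : LogVelocity α t e o l L) (h0 : 2 + (t - 1) * (2 - t) / 2 < vel e l 0)
    (j : ℕ) : 1 < vel e l j ∧ 1 < vel o L j := by
  have ht := H.one_lt
  have ht2 := H.lt_two
  have hprod : 0 < (t - 1) * (2 - t) := mul_pos (by linarith) (by linarith)
  have h0' : 2 - t < vel e l 0 := by linarith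
  rcases Nat.even_or_odd j with hj | ⟨m, rfl⟩
  · have hb := H.bounds_of_even h0' hj
    exact ⟨by linarith [hb.sub_le_vel H hj], by linarith [hb.le_vel_o H hj h0']⟩
  · have hm := even_two_mul m
    refine ⟨by linarith [(H.bounds_of_even h0' hm).le_vel_e_succ H hm h0'], ?_⟩
    have hvel := (H.bounds_of_even h0' (hm.add even_two)).sub_le_vel H (hm.add even_two)
    have hdiv : 1 + (2 - t) / 2 < vel e l (2 * m + 2) / t := by
      rw [lt_div_iff₀ H.param_pos]
      linarith
    linarith [H.div_sub_le_vel_o_succ hm h0']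

end LogVelocity

lemma one_add_log_le_add_mul_exp_neg {A : ℝ} (hA : 0 < A) (s : ℝ) :
    1 + log A ≤ s + A * exp (-s) := by
  have h := add_one_le_exp (log A - s)
  rw [sub_eq_add_neg, exp_add, exp_log hA] at h
  linarith

lemma add_lt_log_mul_one_add {b : ℝ} (hb0 : 0 < b) (hb1 : b < 1) :
    b + b * (1 - b) / 2 < log ((1 + b + b * (1 - b) / 2) * (1 + b)) := by
  have hle : 1 + b ≤ 1 + b + b * (1 - b) / 2 := by nlinarith
  have hrat : b + b * (1 - b) / 2 < 2 * (2 * b / (b + 2)) := by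
    rw [← mul_div_assoc, lt_div_iff₀ (by linarith)]
    nlinarith
  rw [log_mul (by linarith) (by linarith)]
  linarith [le_log_one_add_of_nonneg hb0.le, log_le_log (by linarith) hle]

lemma lt_div_two_mul_sub {α b m : ℝ} (hα : 1 ≤ α) (hb0 : 0 < b) (hb1 : b < 1)
    (hm : (1 + b) * b ^ α ≤ m) (hmb : m < b) :
    1 + b + b * (1 - b) / 2 < (α - 1) * (1 - b ^ 2) / (2 * (b - m)) := by
  have hlog := add_lt_log_mul_one_add hb0 hb1
  set c := 1 + b + b * (1 - b) / 2 with hc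
  have hc0 : 0 < c := by nlinarith
  have hpow : b * exp (-((α - 1) * -log b)) = b ^ α := by
    rw [show -((α - 1) * -log b) = log b * (α - 1) by ring, ← rpow_def_of_pos hb0,
      rpow_sub_one hb0.ne']
    field_simp
  have hexp := one_add_log_le_add_mul_exp_neg (mul_pos hc0 (by linarith : 0 < 1 + b))
    ((α - 1) * -log b)
  have hneglog : b * -log b ≤ (1 - b ^ 2) / 2 := calc
    b * -log b ≤ b * ((b⁻¹ - b⁻¹⁻¹) / 2) := by
      rw [← log_inv]
      gcongr
      exact log_le_sub_inv_div_two ((one_le_inv₀ hb0).2 hb1.le)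
    _ = (1 - b ^ 2) / 2 := by field_simp
  rw [lt_div_iff₀ (by linarith)]
  have hmul : c * b < (α - 1) * (b * -log b) + c * ((1 + b) * b ^ α) := by
    rw [← hpow]
    nlinarith
  nlinarith [mul_le_mul_of_nonneg_left hneglog (sub_nonneg.2 hα),
    mul_le_mul_of_nonneg_left hm hc0.le]

lemma two_add_lt_of_two_div_le {α b m S : ℝ} (hα : 1 ≤ α) (hb0 : 0 < b) (hb1 : b < 1)
    (hm : (1 + b) * b ^ α ≤ m) (hmb : m < b) (hS : 2 / (2 + m) ≤ S) :
    2 + b * (1 - b) / 2 <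
      (1 - b) / 2 * ((1 + m) / (b - m)) * (S * (b + α * (1 + b)) - 1) := by
  have hm0 : 0 < m := lt_of_lt_of_le (by positivity) hm
  have hbm : 0 < b - m := sub_pos.2 hmb
  have hb1' : 0 < 1 - b := sub_pos.2 hb1
  have hmain := lt_div_two_mul_sub hα hb0 hb1 hm hmb
  have hhalf : 1 / 2 ≤ (1 + m) / (2 + m) := by
    rw [div_le_div_iff₀ two_pos (by linarith)]
    linarith
  calc 2 + b * (1 - b) / 2 < (α - 1) * (1 - b ^ 2) / (2 * (b - m)) + (1 - b) := by linarith
    _ = (1 - b) / 2 * (1 / 2) * ((2 * (α - 1) * (1 + b) + 4 * (b - m)) / (b - m)) := by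
        field_simp
        ring
    _ ≤ (1 - b) / 2 * ((1 + m) / (2 + m)) * ((2 * (α - 1) * (1 + b) + (4 * b - m)) / (b - m)) := by
        gcongr
        linarith
    _ = (1 - b) / 2 * ((1 + m) / (b - m)) * (2 / (2 + m) * (b + α * (1 + b)) - 1) := by
        field_simp
        ring
    _ ≤ (1 - b) / 2 * ((1 + m) / (b - m)) * (S * (b + α * (1 + b)) - 1) := by
        gcongr

lemma two_div_le_mul_div_one_add_rpow_sub_one {α z : ℝ} (hα : 0 < α) (hz : 0 < z) :
    2 / (2 + ((1 + z) ^ α - 1)) ≤ α * z / ((1 + z) ^ α - 1) := by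
  have hm : 0 < (1 + z) ^ α - 1 := sub_pos.2 (one_lt_rpow (by linarith) hα)
  have hlower := le_log_one_add_of_nonneg hm.le
  rw [add_sub_cancel, log_rpow (by linarith), add_comm _ (2 : ℝ)] at hlower
  have hupper : α * log (1 + z) ≤ α * z := by
    gcongr
    linarith [log_le_sub_one_of_pos (by linarith : 0 < 1 + z)]
  rw [le_div_iff₀ hm, div_mul_eq_mul_div]
  exact hlower.trans hupper

lemma CriticalOrbit.mul_one_add_zeta_rpow {α t : ℝ} {e o : ℕ → ℝ} (H : CriticalOrbit α t e o)
    (j : ℕ) : (1 + e (j + 1)) * (1 + zeta α t (e j)) ^ α = t := by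
  have ho := H.o_pos j
  rw [H.zeta_eq_one_div_sub_one, add_sub_cancel, H.one_add_e_succ, one_div, inv_rpow ho.le]
  exact mul_inv_cancel_right₀ (rpow_pos_of_pos ho α).ne' t

namespace LogVelocity

variable {α t : ℝ} {e o l L : ℕ → ℝ}

lemma vel_zero_eq (H : LogVelocity α t e o l L) {m : ℝ} (hm : m = (1 + zeta α t (e 1)) ^ α - 1) :
    vel e l 0 = (2 - t) / 2 * ((1 + m) / (t - 1 - m)) *
      (α * zeta α t (e 1) / m * (t - 1 + α * t) - 1) := by
  have ht : t - 1 ≠ 0 := (sub_pos.2 H.one_lt).ne'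
  have hm0 : 0 < m := by
    rw [hm]
    exact sub_pos.2 (one_lt_rpow (by linarith [H.zeta_pos 0]) H.exp_pos)
  have hm1 : 1 + m ≠ 0 := by linarith
  have he2 : (1 + e 2) * (1 + m) = t := by
    rw [hm, add_sub_cancel]
    exact H.mul_one_add_zeta_rpow 1
  have hmul : e 2 * (1 + m) = t - 1 - m := by linarith
  have htm : t - 1 - m ≠ 0 := hmul ▸ mul_ne_zero (H.e_succ_pos 1).ne' hm1
  have hl1 : l 1 = t * ((2 - t) / 2) / (t - 1) := by
    rw [eq_div_iff ht]
    linarith [H.l_one]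
  have hl2 : l 2 = t * ((2 - t) / 2 - α * (zeta α t (e 1) * (α * l 1 + (2 - t) / 2))) /
      (t - 1 - m) := by
    have hsucc : e 2 * l 2 = (1 + e 2) * ((2 - t) / 2 + α * L 1) := H.l_succ 1
    rw [H.L_eq] at hsucc
    rw [eq_div_iff htm, ← hmul]
    linear_combination (1 + m) * hsucc +
      ((2 - t) / 2 - α * (zeta α t (e 1) * (α * l 1 + (2 - t) / 2))) * he2
  have hsub : t - 1 - e 2 = t * m / (1 + m) := by
    rw [eq_div_iff hm1]
    linarith
  have ht0 := H.param_pos.ne'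
  have he1 := H.e_one
  rw [vel, sepVel, sepVel, H.e_zero, zero_mul, zero_div, sub_zero, hl2, hl1]
  generalize zeta α t (e 1) = z
  rw [he1, hsub]
  field_simp
  ring

theorem lt_vel_zero (H : LogVelocity α t e o l L) : 2 + (t - 1) * (2 - t) / 2 < vel e l 0 := by
  have hz := H.zeta_pos 0
  have ho := H.o_pos 1
  have he2 : (1 + e 2) * (1 + zeta α t (e 1)) ^ α = t := H.mul_one_add_zeta_rpow 1
  have hbernoulli : 1 + α * zeta α t (e 1) ≤ (1 + zeta α t (e 1)) ^ α :=
    one_add_mul_self_le_rpow_one_add (by linarith) H.one_lt_exp.le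
  have hpow : t * (t - 1) ^ α ≤ zeta α t (e 1) := by
    rw [← H.e_one, H.zeta_eq]
    exact le_div_self (mul_nonneg H.param_pos.le (rpow_nonneg (H.e_nonneg 1) α)) ho (H.o_le_one 1)
  have hm : (1 + (t - 1)) * (t - 1) ^ α ≤ (1 + zeta α t (e 1)) ^ α - 1 := by
    rw [add_sub_cancel]
    linarith [mul_nonneg (sub_nonneg.2 H.one_lt_exp.le) hz.le]
  have hmb : (1 + zeta α t (e 1)) ^ α - 1 < t - 1 := by
    nlinarith [H.e_succ_pos 1, one_lt_rpow (by linarith : 1 < 1 + zeta α t (e 1)) H.exp_pos]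
  have hbase := two_add_lt_of_two_div_le H.one_lt_exp.le (sub_pos.2 H.one_lt)
    (by linarith [H.lt_two]) hm hmb (two_div_le_mul_div_one_add_rpow_sub_one H.exp_pos hz)
  rw [H.vel_zero_eq rfl]
  rw [add_sub_cancel 1 t, show 1 - (t - 1) = 2 - t by ring] at hbase
  exact hbase

end LogVelocity

/-- `|y (2 j)|` for the critical orbit `y (n + 1) = 1 - t * |y n| ^ α`, when its kneading sequence
is `RLRL…`. -/
noncomputable def evenAbs (α t : ℝ) : ℕ → ℝ
  | 0 => 0
  | j + 1 => t * (1 - t * evenAbs α t j ^ α) ^ α - 1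

/-- `y (2 j + 1)` for the critical orbit `y (n + 1) = 1 - t * |y n| ^ α`, when its kneading sequence
is `RLRL…`. -/
noncomputable def oddPt (α t : ℝ) (j : ℕ) : ℝ := 1 - t * evenAbs α t j ^ α

lemma evenAbs_one {α : ℝ} (hα : α ≠ 0) (t : ℝ) : evenAbs α t 1 = t - 1 := by
  rw [evenAbs, evenAbs, zero_rpow hα, mul_zero, sub_zero, one_rpow, mul_one]

/-- The parameters `t > 1` for which the critical orbit has kneading sequence `RLRL…`. -/
def Admissible (α t : ℝ) : Prop := CriticalOrbit α t (evenAbs α t) (oddPt α t)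

/-- The function bounding the admissible parameters: for `1 < t`, the fourth term of the critical
orbit is negative iff `boundaryFun α t < 1`. Written so that convexity is visible. -/
noncomputable def boundaryFun (α t : ℝ) : ℝ := (t - 1) ^ (α + 1) + (t - 1) ^ α + t ^ (-(1 / α))

lemma boundaryFun_eq {α t : ℝ} (ht : t ≠ 1) :
    boundaryFun α t = t * (t - 1) ^ α + t ^ (-(1 / α)) := by
  rw [boundaryFun, rpow_add_one (sub_ne_zero.2 ht)]
  ring

lemma rpow_neg_one_div_lt_iff {α t y : ℝ} (hα : 0 < α) (ht : 0 < t) (hy : 0 ≤ y) :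
    t ^ (-(1 / α)) < y ↔ 1 < t * y ^ α := by
  rw [← rpow_lt_rpow_iff (by positivity) hy hα, ← rpow_mul ht.le, neg_mul,
    one_div_mul_cancel hα.ne', rpow_neg_one, inv_lt_iff_one_lt_mul₀' ht]

lemma Admissible.boundaryFun_lt {α t : ℝ} (H : Admissible α t) : boundaryFun α t < 1 := by
  have h2 : 0 < t * oddPt α t 1 ^ α - 1 := by
    rw [← H.e_succ]
    exact H.e_succ_pos 1
  have h := (rpow_neg_one_div_lt_iff H.exp_pos H.param_pos (H.o_pos 1).le).2 (by linarith)
  rw [H.o_eq, H.e_one] at h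
  rw [boundaryFun_eq H.one_lt.ne']
  linarith

lemma evenAbs_step_mem {α t : ℝ} (hα : 0 < α) (ht : 1 < t) (hg : boundaryFun α t < 1) {u : ℝ}
    (hu : u ∈ Icc 0 (t - 1)) :
    0 < 1 - t * u ^ α ∧ t * (1 - t * u ^ α) ^ α - 1 ∈ Ioc 0 (t - 1) := by
  have ht0 : 0 < t := by linarith
  rw [boundaryFun_eq ht.ne'] at hg
  have hpow : u ^ α ≤ (t - 1) ^ α := rpow_le_rpow hu.1 hu.2 hα.le
  have hlt : t ^ (-(1 / α)) < 1 - t * u ^ α := by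
    linarith [mul_le_mul_of_nonneg_left hpow ht0.le]
  have hpos : 0 < 1 - t * u ^ α := (rpow_pos_of_pos ht0 _).trans hlt
  have hle : (1 - t * u ^ α) ^ α ≤ 1 :=
    rpow_le_one hpos.le (by linarith [mul_nonneg ht0.le (rpow_nonneg hu.1 α)]) hα.le
  exact ⟨hpos, by linarith [(rpow_neg_one_div_lt_iff hα ht0 hpos.le).1 hlt],
    by linarith [mul_le_mul_of_nonneg_left hle ht0.le]⟩

lemma evenAbs_mem {α t : ℝ} (hα : 0 < α) (ht : 1 < t) (hg : boundaryFun α t < 1) (j : ℕ) :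
    evenAbs α t j ∈ Icc 0 (t - 1) := by
  induction j with
  | zero => exact ⟨le_rfl, (sub_pos.2 ht).le⟩
  | succ j ih => exact Ioc_subset_Icc_self (evenAbs_step_mem hα ht hg ih).2

lemma admissible_iff {α t : ℝ} (hα : 1 < α) : Admissible α t ↔ 1 < t ∧ boundaryFun α t < 1 := by
  refine ⟨fun H => ⟨H.one_lt, H.boundaryFun_lt⟩, fun ⟨ht, hg⟩ => ?_⟩
  have hstep (j : ℕ) := evenAbs_step_mem (by linarith) ht hg (evenAbs_mem (by linarith) ht hg j)
  exact
    { one_lt_exp := hα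
      one_lt := ht
      e_zero := rfl
      o_eq := fun _ => rfl
      e_succ := fun _ => rfl
      o_pos := fun j => (hstep j).1
      e_succ_pos := fun j => (hstep j).2.1 }

lemma hasDerivAt_boundaryFun {α t : ℝ} (hα : 1 ≤ α) (ht : t ≠ 0) :
    HasDerivAt (boundaryFun α)
      ((α + 1) * (t - 1) ^ α + α * (t - 1) ^ (α - 1) + -(1 / α) * t ^ (-(1 / α) - 1)) t := by
  have hsub : HasDerivAt (fun t : ℝ => t - 1) 1 t := (hasDerivAt_id t).sub_const 1
  have h := ((hsub.rpow_const (p := α + 1) (Or.inr (by linarith))).add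
    (hsub.rpow_const (p := α) (Or.inr hα))).add (hasDerivAt_rpow_const (p := -(1 / α)) (Or.inl ht))
  rw [add_sub_cancel_right, one_mul, one_mul] at h
  exact h

lemma convexOn_boundaryFun {α : ℝ} (hα : 1 ≤ α) : ConvexOn ℝ (Ici 1) (boundaryFun α) := by
  have hderiv {t : ℝ} (ht : 1 ≤ t) := hasDerivAt_boundaryFun hα (zero_lt_one.trans_le ht).ne'
  refine MonotoneOn.convexOn_of_deriv (convex_Ici 1)
    (fun t ht => (hderiv ht).continuousAt.continuousWithinAt)
    (fun t ht => (hderiv (interior_subset ht)).differentiableAt.differentiableWithinAt) ?_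
  intro s hs t _ hst
  have hs1 : 1 ≤ s := interior_subset hs
  rw [(hderiv hs1).deriv, (hderiv (hs1.trans hst)).deriv, neg_mul, neg_mul]
  have hinv : 0 < 1 / α := by positivity
  have hpow : t ^ (-(1 / α) - 1) ≤ s ^ (-(1 / α) - 1) :=
    rpow_le_rpow_of_nonpos (by linarith) hst (by linarith)
  gcongr

lemma boundaryFun_one {α : ℝ} (hα : 0 < α) : boundaryFun α 1 = 1 := by
  rw [boundaryFun, sub_self, zero_rpow (by linarith), zero_rpow hα.ne', one_rpow, add_zero,
    zero_add]

lemma one_lt_boundaryFun_two (α : ℝ) : 1 < boundaryFun α 2 := by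
  rw [boundaryFun, show (2 : ℝ) - 1 = 1 by norm_num, one_rpow, one_rpow]
  linarith [rpow_pos_of_pos two_pos (-(1 / α))]

lemma exists_boundaryFun_lt {α : ℝ} (hα : 1 < α) : ∃ s, 1 < s ∧ boundaryFun α s < 1 := by
  have hα0 : 0 < α := by linarith
  have hneg : (α + 1) * ((1 : ℝ) - 1) ^ α + α * ((1 : ℝ) - 1) ^ (α - 1) +
      -(1 / α) * (1 : ℝ) ^ (-(1 / α) - 1) < 0 := by
    rw [sub_self, zero_rpow hα0.ne', zero_rpow (sub_pos.2 hα).ne', one_rpow, mul_zero, mul_zero,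
      add_zero, zero_add, mul_one, neg_lt_zero]
    positivity
  have hslope := ((hasDerivAt_boundaryFun hα.le one_ne_zero).tendsto_slope.mono_left
    (nhdsGT_le_nhdsNE 1)).eventually_lt_const hneg
  obtain ⟨s, h, hs⟩ := (hslope.and self_mem_nhdsWithin).exists
  rw [slope_def_field, boundaryFun_one hα0, div_lt_iff₀ (sub_pos.2 hs), zero_mul] at h
  exact ⟨s, hs, sub_neg.1 h⟩

lemma exists_lt_iff_lt_of_convexOn {g : ℝ → ℝ} {a b s : ℝ} (hg : ConvexOn ℝ (Ici a) g)
    (has : a < s) (hs : g s < g a) (hab : a < b) (hb : g a < g b) :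
    ∃ t₁ ∈ Ioo a b, ∀ t, a < t → (g t < g a ↔ t < t₁) := by
  have between {x y z : ℝ} (hx : a ≤ x) (hxz : x < z) (hzy : z < y) (h : g y < g z) :
      g z < g x :=
    hg.lt_left_of_right_lt hx (hx.trans (hxz.trans hzy).le) (Ioo_subset_openSegment ⟨hxz, hzy⟩) h
  have hsb : s < b := by
    by_contra! hbs
    rcases hbs.eq_or_lt with rfl | hbs
    · exact (hs.trans hb).false
    · exact (hb.trans (between le_rfl hab hbs (hs.trans hb))).false
  have hcont : ContinuousOn g (Icc s b) := hg.continuousOn_interior.mono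
    (by rw [interior_Ici]; exact fun x hx => has.trans_le hx.1)
  obtain ⟨t₁, ⟨hst, htb⟩, ht₁⟩ := intermediate_value_Ioo hsb.le hcont ⟨hs, hb⟩
  refine ⟨t₁, ⟨has.trans hst, htb⟩, fun t hat => ⟨fun ht => ?_, fun ht => ?_⟩⟩
  · by_contra! hle
    have hlt : t₁ < t := hle.lt_of_ne (by rintro rfl; exact (ht₁ ▸ ht).false)
    exact (hs.trans (ht₁ ▸ between has.le hst hlt (ht₁ ▸ ht))).false
  · by_contra! hge
    rcases lt_trichotomy t s with hts | rfl | hst'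
    · exact (hge.trans_lt (between le_rfl hat hts (hs.trans_le hge))).false
    · exact (hge.trans_lt hs).false
    · have hlt := hg.lt_right_of_left_lt (mem_Ici.2 has.le) (mem_Ici.2 (has.trans hst).le)
        (Ioo_subset_openSegment ⟨hst', ht⟩) (hs.trans_le hge)
      exact (hge.trans_lt (hlt.trans_eq ht₁)).false

lemma exists_admissible_iff {α : ℝ} (hα : 1 < α) :
    ∃ t₁ ∈ Ioo (1 : ℝ) 2, ∀ t, Admissible α t ↔ t ∈ Ioo 1 t₁ := by
  obtain ⟨s, hs1, hs⟩ := exists_boundaryFun_lt hα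
  have h1 := boundaryFun_one (by linarith : 0 < α)
  obtain ⟨t₁, ht₁, h⟩ := exists_lt_iff_lt_of_convexOn (convexOn_boundaryFun hα.le) hs1
    (h1.symm ▸ hs) one_lt_two (h1.symm ▸ one_lt_boundaryFun_two α)
  rw [h1] at h
  exact ⟨t₁, ht₁, fun t => (admissible_iff hα).trans (and_congr_right (h t))⟩

lemma f_neg_mul {α a u : ℝ} (ha : 0 < a) (hu : 0 ≤ u) :
    f α a (-(a * u)) = a * (1 - a ^ (α - 1) * u ^ α) := by
  rw [f, abs_neg, abs_of_nonneg (mul_nonneg ha.le hu), mul_rpow ha.le hu, rpow_sub_one ha.ne']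
  field_simp
  ring

lemma f_mul {α a u : ℝ} (ha : 0 < a) (hu : 0 ≤ u) :
    f α a (a * u) = -(a * (a ^ (α - 1) * u ^ α - 1)) := by
  rw [f, abs_of_nonneg (mul_nonneg ha.le hu), mul_rpow ha.le hu, rpow_sub_one ha.ne']
  field_simp
  ring

lemma f_zero {α : ℝ} (hα : α ≠ 0) (a : ℝ) : f α a 0 = a := by
  rw [f, abs_zero, zero_rpow hα, neg_zero, zero_add]

lemma side_eq_R_iff {x : ℝ} : side x = Side.R ↔ 0 < x := by
  grind [side]

lemma side_eq_L_iff {x : ℝ} : side x = Side.L ↔ x < 0 := by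
  grind [side]

lemma mem_RLRL_iff_sign {α a : ℝ} : a ∈ RLRL α ↔
    ∀ j, 0 < (f α a)^[2 * j + 1] 0 ∧ (f α a)^[2 * j + 2] 0 < 0 := by
  refine ⟨fun h j => ⟨?_, ?_⟩, fun h n => ?_⟩
  · exact side_eq_R_iff.1 ((h (2 * j)).trans (if_pos (even_two_mul j)))
  · exact side_eq_L_iff.1 ((h (2 * j + 1)).trans (if_neg (Nat.not_even_two_mul_add_one j)))
  · obtain ⟨j, rfl | rfl⟩ := Nat.even_or_odd' n
    · exact (side_eq_R_iff.2 (h j).1).trans (if_pos (even_two_mul j)).symm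
    · exact (side_eq_L_iff.2 (h j).2).trans (if_neg (Nat.not_even_two_mul_add_one j)).symm

section iterate

variable {α a : ℝ} {j : ℕ}

lemma iterate_odd_eq (ha : 0 < a) (he : 0 ≤ evenAbs α (a ^ (α - 1)) j)
    (h : (f α a)^[2 * j] 0 = -(a * evenAbs α (a ^ (α - 1)) j)) :
    (f α a)^[2 * j + 1] 0 = a * oddPt α (a ^ (α - 1)) j := by
  rw [Function.iterate_succ_apply', h, f_neg_mul ha he, oddPt]

lemma iterate_even_succ_eq (ha : 0 < a) (ho : 0 ≤ oddPt α (a ^ (α - 1)) j)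
    (h : (f α a)^[2 * j + 1] 0 = a * oddPt α (a ^ (α - 1)) j) :
    (f α a)^[2 * j + 2] 0 = -(a * evenAbs α (a ^ (α - 1)) (j + 1)) := by
  rw [Function.iterate_succ_apply', h, f_mul ha ho, evenAbs, oddPt]

lemma Admissible.iterate_eq (ha : 0 < a) (H : Admissible α (a ^ (α - 1))) (j : ℕ) :
    (f α a)^[2 * j] 0 = -(a * evenAbs α (a ^ (α - 1)) j) ∧
      (f α a)^[2 * j + 1] 0 = a * oddPt α (a ^ (α - 1)) j := by
  induction j with
  | zero =>
    have h0 : (f α a)^[2 * 0] 0 = -(a * evenAbs α (a ^ (α - 1)) 0) := by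
      rw [H.e_zero, mul_zero, mul_zero, neg_zero, Function.iterate_zero_apply]
    exact ⟨h0, iterate_odd_eq ha (H.e_nonneg 0) h0⟩
  | succ j ih =>
    have heven := iterate_even_succ_eq ha (H.o_pos j).le ih.2
    exact ⟨heven, iterate_odd_eq ha (H.e_nonneg (j + 1)) heven⟩

lemma oddPt_pos_and_evenAbs_succ_pos (ha : 0 < a)
    (hsign : 0 < (f α a)^[2 * j + 1] 0 ∧ (f α a)^[2 * j + 2] 0 < 0)
    (he : 0 ≤ evenAbs α (a ^ (α - 1)) j)
    (h : (f α a)^[2 * j] 0 = -(a * evenAbs α (a ^ (α - 1)) j)) :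
    0 < oddPt α (a ^ (α - 1)) j ∧ 0 < evenAbs α (a ^ (α - 1)) (j + 1) := by
  have hodd := iterate_odd_eq ha he h
  have ho : 0 < oddPt α (a ^ (α - 1)) j := pos_of_mul_pos_right (hodd ▸ hsign.1) ha.le
  have heven := iterate_even_succ_eq ha ho.le hodd
  exact ⟨ho, pos_of_mul_pos_right (neg_lt_zero.1 (heven ▸ hsign.2)) ha.le⟩

lemma mem_RLRL_iff (hα : 1 < α) : a ∈ RLRL α ↔ 0 < a ∧ Admissible α (a ^ (α - 1)) := by
  rw [mem_RLRL_iff_sign]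
  refine ⟨fun hsign => ?_, fun ⟨ha, H⟩ j => ?_⟩
  · have ha : 0 < a := by
      have h := (hsign 0).1
      rwa [mul_zero, zero_add, Function.iterate_one, f_zero (by linarith)] at h
    have heven (j : ℕ) : 0 ≤ evenAbs α (a ^ (α - 1)) j ∧
        (f α a)^[2 * j] 0 = -(a * evenAbs α (a ^ (α - 1)) j) := by
      induction j with
      | zero => exact ⟨le_rfl, by rw [evenAbs, mul_zero, mul_zero, neg_zero]; rfl⟩
      | succ j ih =>
        have hpos := oddPt_pos_and_evenAbs_succ_pos ha (hsign j) ih.1 ih.2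
        exact ⟨hpos.2.le, iterate_even_succ_eq ha hpos.1.le (iterate_odd_eq ha ih.1 ih.2)⟩
    have hpos (j : ℕ) := oddPt_pos_and_evenAbs_succ_pos ha (hsign j) (heven j).1 (heven j).2
    have ht : 0 < a ^ (α - 1) - 1 := by
      rw [← evenAbs_one (by linarith : α ≠ 0)]
      exact (hpos 0).2
    exact ⟨ha,
      { one_lt_exp := hα
        one_lt := sub_pos.1 ht
        e_zero := rfl
        o_eq := fun _ => rfl
        e_succ := fun _ => rfl
        o_pos := fun j => (hpos j).1
        e_succ_pos := fun j => (hpos j).2 }⟩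
  · have heven : (f α a)^[2 * j + 2] 0 = -(a * evenAbs α (a ^ (α - 1)) (j + 1)) :=
      (H.iterate_eq ha (j + 1)).1
    rw [(H.iterate_eq ha j).2, heven]
    exact ⟨mul_pos ha (H.o_pos j), neg_lt_zero.2 (mul_pos ha (H.e_succ_pos j))⟩

lemma pt_two_mul (hα : 1 < α) (ha : a ∈ RLRL α) (j : ℕ) :
    pt α a (2 * j) = -evenAbs α (a ^ (α - 1)) j := by
  obtain ⟨ha, H⟩ := (mem_RLRL_iff hα).1 ha
  rw [pt, (H.iterate_eq ha j).1, f_zero H.exp_pos.ne', ← mul_neg, mul_div_cancel_left₀ _ ha.ne']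

lemma pt_two_mul_add_one (hα : 1 < α) (ha : a ∈ RLRL α) (j : ℕ) :
    pt α a (2 * j + 1) = oddPt α (a ^ (α - 1)) j := by
  obtain ⟨ha, H⟩ := (mem_RLRL_iff hα).1 ha
  rw [pt, (H.iterate_eq ha j).2, f_zero H.exp_pos.ne', mul_div_cancel_left₀ _ ha.ne']

end iterate

/-- The logarithmic velocity of `evenAbs α t (j + 1)`, when that of `oddPt α t j` is `L` and `log t`
moves with velocity `(2 - t) / 2`. -/
noncomputable def evenSuccVel (α t L : ℝ) (j : ℕ) : ℝ :=
  (1 + evenAbs α t (j + 1)) * ((2 - t) / 2 + α * L) / evenAbs α t (j + 1)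

/-- The logarithmic velocity of `oddPt α t`, when `log t` moves with velocity `(2 - t) / 2`. -/
noncomputable def oddVel (α t : ℝ) : ℕ → ℝ
  | 0 => 0
  | j + 1 => -(zeta α t (evenAbs α t (j + 1)) *
      (α * evenSuccVel α t (oddVel α t j) j + (2 - t) / 2))

/-- The logarithmic velocity of `evenAbs α t`, when `log t` moves with velocity `(2 - t) / 2`. At
index `0`, where `evenAbs` vanishes, it takes the value prescribed by `LogVelocity.l_zero`. -/
noncomputable def evenVel (α t : ℝ) : ℕ → ℝ
  | 0 => evenSuccVel α t (oddVel α t 0) 0 - evenAbs α t 1 *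
      (evenSuccVel α t (oddVel α t 0) 0 - evenSuccVel α t (oddVel α t 1) 1) /
        (evenAbs α t 1 - evenAbs α t 2)
  | j + 1 => evenSuccVel α t (oddVel α t j) j

namespace Admissible

variable {α t : ℝ}

lemma logVelocity (H : Admissible α t) :
    LogVelocity α t (evenAbs α t) (oddPt α t) (evenVel α t) (oddVel α t) where
  toCriticalOrbit := H
  L_eq j := by
    cases j with
    | zero =>
      have hzeta : zeta α t (evenAbs α t 0) = 0 := H.zeta_zero
      rw [hzeta, zero_mul, neg_zero, oddVel]
    | succ j => rfl
  l_succ j := by rw [evenVel, evenSuccVel, mul_div_cancel₀ _ (H.e_succ_pos j).ne']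
  l_zero := by
    rw [vel, sepVel, sepVel, H.e_zero, zero_mul, zero_div, sub_zero]
    rfl

lemma hasDerivAt_oddPt (H : Admissible α t) {j : ℕ} (h : HasDerivAt (fun s => evenAbs α s j)
    (evenAbs α t j * evenVel α t j / (t * ((2 - t) / 2))) t) :
    HasDerivAt (fun s => oddPt α s j) (oddPt α t j * oddVel α t j / (t * ((2 - t) / 2))) t := by
  have hw : 2 - t ≠ 0 := (sub_pos.2 H.lt_two).ne'
  have ht := H.param_pos.ne'
  have ho := (H.o_pos j).ne'
  have hpow : evenAbs α t j ^ α = evenAbs α t j * evenAbs α t j ^ (α - 1) := by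
    rw [← rpow_one_add' (H.e_nonneg j) (by linarith [H.exp_pos]), add_sub_cancel]
  refine (((hasDerivAt_id t).mul
    (h.rpow_const (p := α) (Or.inr H.one_lt_exp.le))).const_sub 1).congr_deriv ?_
  rw [H.logVelocity.L_eq, H.zeta_eq, hpow]
  simp only [id, one_mul]
  field_simp
  ring

lemma hasDerivAt_evenAbs_succ (H : Admissible α t) {j : ℕ} (h : HasDerivAt (fun s => oddPt α s j)
    (oddPt α t j * oddVel α t j / (t * ((2 - t) / 2))) t) :
    HasDerivAt (fun s => evenAbs α s (j + 1))
      (evenAbs α t (j + 1) * evenVel α t (j + 1) / (t * ((2 - t) / 2))) t := by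
  have hw : 2 - t ≠ 0 := (sub_pos.2 H.lt_two).ne'
  have ht := H.param_pos.ne'
  have ho := (H.o_pos j).ne'
  refine (((hasDerivAt_id t).mul
    (h.rpow_const (p := α) (Or.inr H.one_lt_exp.le))).sub_const 1).congr_deriv ?_
  rw [H.logVelocity.l_succ, H.e_succ, rpow_sub_one ho]
  simp only [id, one_mul]
  field_simp
  ring

lemma hasDerivAt_evenAbs (H : Admissible α t) (j : ℕ) : HasDerivAt (fun s => evenAbs α s j)
    (evenAbs α t j * evenVel α t j / (t * ((2 - t) / 2))) t := by
  induction j with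
  | zero =>
    rw [H.e_zero, zero_mul, zero_div]
    exact hasDerivAt_const t 0
  | succ j ih => exact H.hasDerivAt_evenAbs_succ (H.hasDerivAt_oddPt ih)

end Admissible

lemma hasDerivAt_poincare {p q x : ℝ → ℝ} {p' q' x' t : ℝ} (hp : HasDerivAt p p' t)
    (hq : HasDerivAt q q' t) (hx : HasDerivAt x x' t) (hpx : x t ≠ p t) (hqx : q t ≠ x t) :
    HasDerivAt (fun s => poincare (p s) (q s) (x s))
      ((x' - p') / (x t - p t) - (q' - x') / (q t - x t)) t := by
  have hpx' := sub_ne_zero.2 hpx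
  have hqx' := sub_ne_zero.2 hqx
  refine (((hx.sub hp).div (hq.sub hx) hqx').log (div_ne_zero hpx' hqx')).congr_deriv ?_
  simp only [Pi.sub_apply, Pi.div_apply]
  field_simp

lemma hasDerivAt_poincare_zero_two {t : ℝ} (h0 : t ≠ 0) (h2 : t ≠ 2) :
    HasDerivAt (poincare 0 2) (1 / (t * ((2 - t) / 2))) t := by
  have hsub := sub_ne_zero.2 h2.symm
  refine (hasDerivAt_poincare (hasDerivAt_const t 0) (hasDerivAt_const t 2) (hasDerivAt_id t) h0
    h2.symm).congr_deriv ?_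
  simp only [id, sub_zero, zero_sub]
  field_simp
  ring

lemma hasDerivAt_poincare_of_logVelocity {a : ℝ → ℕ → ℝ} {l : ℕ → ℝ} {w t : ℝ} {j : ℕ}
    (h : ∀ k, HasDerivAt (fun s => a s k) (a t k * l k / w) t)
    (h02 : a t j ≠ a t (j + 2)) (h12 : a t (j + 1) ≠ a t (j + 2)) :
    HasDerivAt (fun s => poincare (a s (j + 1)) (a s j) (a s (j + 2))) (vel (a t) l j / w) t := by
  have hsub12 := sub_ne_zero.2 h12
  have hsub02 := sub_ne_zero.2 h02
  refine (hasDerivAt_poincare (h (j + 1)) (h j) (h (j + 2)) h12.symm h02).congr_deriv ?_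
  rw [vel, sepVel, sepVel, ← neg_sub (a t (j + 1)) (a t (j + 2)), div_neg]
  field_simp
  ring

lemma strictMonoOn_poincare_sub {a l : ℝ → ℕ → ℝ} {t₁ : ℝ} {j : ℕ} (ht₁ : t₁ ≤ 2)
    (h : ∀ t ∈ Ioo 1 t₁, ∀ k, HasDerivAt (fun s => a s k) (a t k * l t k / (t * ((2 - t) / 2))) t)
    (h02 : ∀ t ∈ Ioo 1 t₁, a t j ≠ a t (j + 2))
    (h12 : ∀ t ∈ Ioo 1 t₁, a t (j + 1) ≠ a t (j + 2))
    (hvel : ∀ t ∈ Ioo 1 t₁, 1 < vel (a t) (l t) j) :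
    StrictMonoOn (fun s => poincare (a s (j + 1)) (a s j) (a s (j + 2)) - poincare 0 2 s)
      (Ioo 1 t₁) := by
  have hderiv (t : ℝ) (ht : t ∈ Ioo 1 t₁) :=
    (hasDerivAt_poincare_of_logVelocity (h t ht) (h02 t ht) (h12 t ht)).sub
      (hasDerivAt_poincare_zero_two (zero_lt_one.trans ht.1).ne' (ht.2.trans_le ht₁).ne)
  refine strictMonoOn_of_hasDerivWithinAt_pos (convex_Ioo 1 t₁)
    (fun t ht => (hderiv t ht).continuousAt.continuousWithinAt)
    (fun t ht => (hderiv t (interior_subset ht)).hasDerivWithinAt) fun t ht => ?_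
  have ht := interior_subset ht
  rw [← sub_div]
  exact div_pos (sub_pos.2 (hvel t ht)) (mul_pos (by linarith [ht.1]) (by linarith [ht.2]))

lemma strictMonoOn_poincare_evenAbs_sub {α t₁ : ℝ} (ht₁ : t₁ ≤ 2)
    (hadm : ∀ t ∈ Ioo 1 t₁, Admissible α t) (j : ℕ) :
    StrictMonoOn (fun s => poincare (evenAbs α s (j + 1)) (evenAbs α s j) (evenAbs α s (j + 2)) -
      poincare 0 2 s) (Ioo 1 t₁) :=
  strictMonoOn_poincare_sub ht₁ (fun t ht => (hadm t ht).hasDerivAt_evenAbs)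
    (fun t ht => (hadm t ht).e_ne_add_two j) (fun t ht => (hadm t ht).e_ne_succ j)
    fun t ht => ((hadm t ht).logVelocity.one_lt_vel (hadm t ht).logVelocity.lt_vel_zero j).1

lemma strictMonoOn_poincare_oddPt_sub {α t₁ : ℝ} (ht₁ : t₁ ≤ 2)
    (hadm : ∀ t ∈ Ioo 1 t₁, Admissible α t) (j : ℕ) :
    StrictMonoOn (fun s => poincare (oddPt α s (j + 1)) (oddPt α s j) (oddPt α s (j + 2)) -
      poincare 0 2 s) (Ioo 1 t₁) :=
  strictMonoOn_poincare_sub ht₁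
    (fun t ht k => (hadm t ht).hasDerivAt_oddPt ((hadm t ht).hasDerivAt_evenAbs k))
    (fun t ht => (hadm t ht).o_ne ((hadm t ht).e_ne_add_two j))
    (fun t ht => (hadm t ht).o_ne ((hadm t ht).e_ne_succ j))
    fun t ht => ((hadm t ht).logVelocity.one_lt_vel (hadm t ht).logVelocity.lt_vel_zero j).2

lemma poincare_neg (p q x : ℝ) : poincare (-p) (-q) (-x) = poincare p q x := by
  rw [poincare, poincare, ← neg_div_neg_eq]
  congr 2 <;> ring

lemma strictMonoOn_poincare (p q : ℝ) : StrictMonoOn (poincare p q) (Ioo p q) := by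
  intro x hx y hy hxy
  exact log_lt_log (div_pos (sub_pos.2 hx.1) (sub_pos.2 hx.2))
    (div_lt_div₀ (by linarith) (by linarith) (by linarith [hy.1]) (sub_pos.2 hy.2))

lemma surjOn_poincare {p q : ℝ} (h : p < q) : SurjOn (poincare p q) (Ioo p q) univ := by
  intro z _
  have hz := Real.exp_pos z
  refine ⟨(p + q * exp z) / (1 + exp z), ⟨?_, ?_⟩, ?_⟩
  · rw [lt_div_iff₀ (by positivity)]
    linarith [mul_lt_mul_of_pos_right h hz]
  · rw [div_lt_iff₀ (by positivity)]
    linarith [mul_lt_mul_of_pos_right h hz]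
  · have hratio : ((p + q * exp z) / (1 + exp z) - p) / (q - (p + q * exp z) / (1 + exp z)) =
        exp z := by
      have hnum : (p + q * exp z) / (1 + exp z) - p = exp z * ((q - p) / (1 + exp z)) := by
        field_simp
        ring
      have hden : q - (p + q * exp z) / (1 + exp z) = (q - p) / (1 + exp z) := by
        field_simp
        ring
      rw [hnum, hden, mul_div_cancel_right₀ _ (div_ne_zero (sub_ne_zero.2 h.ne')
        (by positivity))]
    rw [poincare, hratio, log_exp]

lemma image_poincare_Ioo {p q r : ℝ} (hr : r ∈ Ioo p q) :
    poincare p q '' Ioo p r = Iio (poincare p q r) := by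
  have hmono := strictMonoOn_poincare p q
  ext z
  constructor
  · rintro ⟨x, hx, rfl⟩
    exact hmono ⟨hx.1, hx.2.trans hr.2⟩ hr hx.2
  · intro hz
    obtain ⟨x, hx, rfl⟩ := surjOn_poincare (hr.1.trans hr.2) (mem_univ z)
    exact ⟨x, ⟨hx.1, (hmono.lt_iff_lt hx hr).1 hz⟩, rfl⟩

lemma sub_div_sub_pos {p q x : ℝ} (h : q < x ∧ x < p ∨ p < x ∧ x < q) :
    0 < (x - p) / (q - x) := by
  rcases h with ⟨hq, hp⟩ | ⟨hp, hq⟩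
  · exact div_pos_of_neg_of_neg (by linarith) (by linarith)
  · exact div_pos (by linarith) (by linarith)

lemma abs_sub_div_abs_sub_eq {p q x : ℝ} (h : 0 < (x - p) / (q - x)) :
    |x - p| / |p - q| = (x - p) / (q - x) / (1 + (x - p) / (q - x)) := by
  have hqx : q - x ≠ 0 := (div_ne_zero_iff.1 h.ne').2
  have hquot : (x - p) / (q - x) / (1 + (x - p) / (q - x)) = (x - p) / (q - p) := by
    rw [one_add_div hqx, div_div_div_cancel_right₀ hqx, sub_add_sub_cancel]
  have hpos : 0 < (x - p) / (q - p) := by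
    rw [← hquot]
    positivity
  rw [hquot, abs_sub_comm p q, ← abs_div, abs_of_pos hpos]

lemma abs_sub_div_abs_sub_lt {p q x p' q' x' : ℝ} (h : 0 < (x - p) / (q - x))
    (h' : 0 < (x' - p') / (q' - x')) (hlt : poincare p q x < poincare p' q' x') :
    |x - p| / |p - q| < |x' - p'| / |p' - q'| := by
  have hratio : (x - p) / (q - x) < (x' - p') / (q' - x') := (log_lt_log_iff h h').1 hlt
  rw [abs_sub_div_abs_sub_eq h, abs_sub_div_abs_sub_eq h', div_lt_div_iff₀ (by linarith)
    (by linarith)]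
  linarith

section RLRL

variable {α a a' : ℝ}

lemma pt_two (hα : 1 < α) (ha : a ∈ RLRL α) : pt α a 2 = 1 - a ^ (α - 1) := by
  have h : pt α a 2 = -evenAbs α (a ^ (α - 1)) 1 := pt_two_mul hα ha 1
  rw [h, evenAbs_one (by linarith), neg_sub]

lemma poincare_one_neg_one_pt_two (hα : 1 < α) (ha : a ∈ RLRL α) :
    poincare 1 (-1) (pt α a 2) = poincare 0 2 (a ^ (α - 1)) := by
  rw [pt_two hα ha, ← poincare_neg, poincare, poincare]
  congr 2 <;> ring

lemma abar_eq (hα : 1 < α) (ha : a ∈ RLRL α) : abar α a = poincare 1 2 (a ^ (α - 1)) := by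
  have ht := ((mem_RLRL_iff hα).1 ha).2.one_lt
  rw [abar, pt_two hα ha, abs_of_neg (by linarith), poincare, poincare]
  congr 2 <;> ring

lemma rpow_mem_Ioo (hα : 1 < α) (ha : a ∈ RLRL α) : a ^ (α - 1) ∈ Ioo (1 : ℝ) 2 :=
  have H := ((mem_RLRL_iff hα).1 ha).2
  ⟨H.one_lt, H.lt_two⟩

lemma rpow_lt_rpow_of_mem (hα : 1 < α) (ha : a ∈ RLRL α) (h : a < a') :
    a ^ (α - 1) < a' ^ (α - 1) :=
  rpow_lt_rpow ((mem_RLRL_iff hα).1 ha).1.le h (sub_pos.2 hα)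

theorem strictMonoOn_abar (hα : 1 < α) : StrictMonoOn (abar α) (RLRL α) := by
  intro a ha a' ha' h
  rw [abar_eq hα ha, abar_eq hα ha']
  exact strictMonoOn_poincare 1 2 (rpow_mem_Ioo hα ha) (rpow_mem_Ioo hα ha')
    (rpow_lt_rpow_of_mem hα ha h)

theorem exists_image_abar_eq_Iio (hα : 1 < α) : ∃ abar₁, abar α '' RLRL α = Iio abar₁ := by
  obtain ⟨t₁, ht₁, hadm⟩ := exists_admissible_iff hα
  have himage : (· ^ (α - 1)) '' RLRL α = Ioo 1 t₁ := by
    ext t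
    constructor
    · rintro ⟨a, ha, rfl⟩
      exact (hadm _).1 ((mem_RLRL_iff hα).1 ha).2
    · intro ht
      have ht0 : 0 < t := zero_lt_one.trans ht.1
      have hpow : (t ^ (α - 1)⁻¹) ^ (α - 1) = t := rpow_inv_rpow ht0.le (sub_pos.2 hα).ne'
      refine ⟨t ^ (α - 1)⁻¹, (mem_RLRL_iff hα).2 ⟨rpow_pos_of_pos ht0 _, ?_⟩, hpow⟩
      rw [hpow]
      exact (hadm t).2 ht
  refine ⟨poincare 1 2 t₁, ?_⟩
  rw [image_congr fun a ha => abar_eq hα ha, ← image_image (poincare 1 2), himage,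
    image_poincare_Ioo ht₁]

lemma pt_between (hα : 1 < α) (ha : a ∈ RLRL α) (n : ℕ) :
    pt α a n < pt α a (n + 4) ∧ pt α a (n + 4) < pt α a (n + 2) ∨
      pt α a (n + 2) < pt α a (n + 4) ∧ pt α a (n + 4) < pt α a n := by
  have H := ((mem_RLRL_iff hα).1 ha).2
  obtain ⟨j, rfl | rfl⟩ := Nat.even_or_odd' n
  · have h2 : pt α a (2 * j + 2) = _ := pt_two_mul hα ha (j + 1)
    have h4 : pt α a (2 * j + 4) = _ := pt_two_mul hα ha (j + 2)
    rw [pt_two_mul hα ha, h2, h4]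
    simp only [neg_lt_neg_iff]
    exact (H.e_between j).symm.imp And.symm And.symm
  · have h2 : pt α a (2 * j + 1 + 2) = _ := pt_two_mul_add_one hα ha (j + 1)
    have h4 : pt α a (2 * j + 1 + 4) = _ := pt_two_mul_add_one hα ha (j + 2)
    rw [pt_two_mul_add_one hα ha, h2, h4]
    exact H.o_between j

lemma poincare_pt_even (hα : 1 < α) (ha : a ∈ RLRL α) (j : ℕ) :
    poincare (pt α a (2 * j + 2)) (pt α a (2 * j)) (pt α a (2 * j + 4)) =
      poincare (evenAbs α (a ^ (α - 1)) (j + 1)) (evenAbs α (a ^ (α - 1)) j)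
        (evenAbs α (a ^ (α - 1)) (j + 2)) := by
  have h2 : pt α a (2 * j + 2) = _ := pt_two_mul hα ha (j + 1)
  have h4 : pt α a (2 * j + 4) = _ := pt_two_mul hα ha (j + 2)
  rw [h2, h4, pt_two_mul hα ha, poincare_neg]

lemma poincare_pt_odd (hα : 1 < α) (ha : a ∈ RLRL α) (j : ℕ) :
    poincare (pt α a (2 * j + 1 + 2)) (pt α a (2 * j + 1)) (pt α a (2 * j + 1 + 4)) =
      poincare (oddPt α (a ^ (α - 1)) (j + 1)) (oddPt α (a ^ (α - 1)) j)
        (oddPt α (a ^ (α - 1)) (j + 2)) := by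
  have h2 : pt α a (2 * j + 1 + 2) = _ := pt_two_mul_add_one hα ha (j + 1)
  have h4 : pt α a (2 * j + 1 + 4) = _ := pt_two_mul_add_one hα ha (j + 2)
  rw [h2, h4, pt_two_mul_add_one hα ha]

theorem poincare_sub_gt (hα : 1 < α) (ha : a ∈ RLRL α) (ha' : a' ∈ RLRL α) (h : a < a') (n : ℕ) :
    poincare (pt α a' (n + 2)) (pt α a' n) (pt α a' (n + 4)) -
        poincare (pt α a (n + 2)) (pt α a n) (pt α a (n + 4)) >
      poincare 1 (-1) (pt α a' 2) - poincare 1 (-1) (pt α a 2) := by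
  obtain ⟨t₁, ht₁, hadm⟩ := exists_admissible_iff hα
  have ht := (hadm _).1 ((mem_RLRL_iff hα).1 ha).2
  have ht' := (hadm _).1 ((mem_RLRL_iff hα).1 ha').2
  have htt' := rpow_lt_rpow_of_mem hα ha h
  rw [poincare_one_neg_one_pt_two hα ha, poincare_one_neg_one_pt_two hα ha']
  obtain ⟨j, rfl | rfl⟩ := Nat.even_or_odd' n
  · have hmono := strictMonoOn_poincare_evenAbs_sub ht₁.2.le (fun t => (hadm t).2) j ht ht' htt'
    rw [poincare_pt_even hα ha, poincare_pt_even hα ha']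
    dsimp only at hmono
    linarith
  · have hmono := strictMonoOn_poincare_oddPt_sub ht₁.2.le (fun t => (hadm t).2) j ht ht' htt'
    rw [poincare_pt_odd hα ha, poincare_pt_odd hα ha']
    dsimp only at hmono
    linarith

theorem abs_pt_sub_div_lt (hα : 1 < α) (ha : a ∈ RLRL α) (ha' : a' ∈ RLRL α) (h : a < a') (n : ℕ) :
    |pt α a (n + 4) - pt α a (n + 2)| / |pt α a (n + 2) - pt α a n| <
      |pt α a' (n + 4) - pt α a' (n + 2)| / |pt α a' (n + 2) - pt α a' n| := by
  have hgt := poincare_sub_gt hα ha ha' h n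
  have htwo : poincare 1 (-1) (pt α a 2) < poincare 1 (-1) (pt α a' 2) := by
    rw [poincare_one_neg_one_pt_two hα ha, poincare_one_neg_one_pt_two hα ha']
    exact strictMonoOn_poincare 0 2 (Ioo_subset_Ioo_left zero_le_one (rpow_mem_Ioo hα ha))
      (Ioo_subset_Ioo_left zero_le_one (rpow_mem_Ioo hα ha')) (rpow_lt_rpow_of_mem hα ha h)
  exact abs_sub_div_abs_sub_lt (sub_div_sub_pos (pt_between hα ha n))
    (sub_div_sub_pos (pt_between hα ha' n)) (by linarith)

end RLRL

end PowerLaw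

theorem theorem5p1 (α : ℝ) (hα : 1 < α) :
    ∃ abar₁ : ℝ,
      StrictMonoOn (PowerLaw.abar α) (PowerLaw.RLRL α) ∧
      PowerLaw.abar α '' PowerLaw.RLRL α = Set.Iio abar₁ ∧
      ∀ a ∈ PowerLaw.RLRL α, ∀ a' ∈ PowerLaw.RLRL α,
        PowerLaw.abar α a < PowerLaw.abar α a' →
          (∀ n : ℕ, PowerLaw.ratioEven α n a < PowerLaw.ratioEven α n a') ∧
          (∀ n : ℕ, PowerLaw.ratioOdd α n a < PowerLaw.ratioOdd α n a') ∧
          (∀ n : ℕ,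
            PowerLaw.poincare (PowerLaw.pt α a' (n + 2)) (PowerLaw.pt α a' n)
                (PowerLaw.pt α a' (n + 4)) -
              PowerLaw.poincare (PowerLaw.pt α a (n + 2)) (PowerLaw.pt α a n)
                (PowerLaw.pt α a (n + 4)) >
            PowerLaw.poincare 1 (-1) (PowerLaw.pt α a' 2) -
              PowerLaw.poincare 1 (-1) (PowerLaw.pt α a 2)) := by
  obtain ⟨abar₁, himage⟩ := PowerLaw.exists_image_abar_eq_Iio hα
  have hmono := PowerLaw.strictMonoOn_abar hα
  refine ⟨abar₁, hmono, himage, fun a ha a' ha' hlt => ?_⟩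
  have h : a < a' := (hmono.lt_iff_lt ha ha').1 hlt
  have hratio := PowerLaw.abs_pt_sub_div_lt hα ha ha' h
  exact ⟨fun n => hratio (2 * n), fun n => hratio (2 * n + 1), PowerLaw.poincare_sub_gt hα ha ha' h⟩
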